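/- **Setting.** Let $\Gamma$ be a finite connected graph, $f\colon\Gamma\to\Gamma$ a homotopy equivalence that maps vertices to vertices and each edge across a (non-constant) edge-path, and assume that $f$ fixes a vertex $*$. Let $H\subseteq\Gamma$ be a subgraph with $f(H)\subseteq H$. Put $\mathbb F=\pi_1(\Gamma,*)$ and let $\Phi_f\in\mathrm{Aut}(\mathbb F)$ be the automorphism induced by $f$. Let $\widetilde\Gamma$ be the universal cover, $\widetilde H\subseteq\widetilde\Gamma$ the preimage of $H$, $\tilde f$ the lift of $f$ that fixes a chosen lift of $*$, and $A_f$ the map induced by $\tilde f$ on $C_1(\widetilde\Gamma;\mathbb Q)$, so that $A_f(gx)=\Phi_f(g)A_f(x)$ for $g\in\mathbb F$. Let $C_1(\widetilde\Gamma,\widetilde H;\mathbb Q)$ be the $\mathbb Q[\mathbb F]$-module of the rational 1-chains $x=\sum_e x_e e$ with $x_e=0$ for all edges $e$ of $\widetilde H$, let $\pi_H^\perp$ be the projection of $C_1(\widetilde\Gamma;\mathbb Q)$ onto it that deletes the coefficients on $\widetilde H$, and let $A=A_{f,H}=\pi_H^\perp\circ A_f$ on $C_1(\widetilde\Gamma,\widetilde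 H;\mathbb Q)$. Use $\langle x,x'\rangle=\sum_e x_ex'_e$, $\|x\|^2=\langle x,x\rangle$ and $\operatorname{supp}(x)=\{e: x_e\ne0\}$. For distinct vertices $u,v$ of $\widetilde\Gamma$ let $[u,v]$ be the 1-chain with $\partial[u,v]=v-u$. **Nielsen 1-chains.** A *Nielsen 1-chain* is a chain $\rho=\pi_H^\perp([u,v])$ with $u\neq v$, $\tilde f(u)=u$, $\tilde f(v)=v$, such that one of the following holds. * (non-geometric) There is an edge $e$ of $\widetilde\Gamma$ not in $\widetilde H$ with $\rho_e=\pm1$ and $\rho_{ge}=0$ for all $g\in\mathbb F\setminus\{1\}$. * (geometric) (i) For distinct $g_1,g_2\in\mathbb F$, $\operatorname{supp}(g_1\rho)\cap\operatorname{supp}(g_2\rho)$ is empty or a single edge; (ii) for every edge $e$ of $\widetilde\Gamma$ not in $\widetilde H$ there is exactly one unordered pair of distinct elements $g_1,g_2\in\mathbb F$ with $\operatorname{supp}(g_1\rho)\cap\operatorname{supp}(g_2\rho)=\{e\}$; (iii) there are non-commuting $g_1,g_2\in\mathbb F$ such that $\operatorname{supp}(\rho)\cap\operatorname{supp}(g_i\rho)\neq\emptyset$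 for $i=1,2$. **Chain flare condition.** For a $\mathbb Q[\mathbb F]$-submodule $V$ and $0<\theta<1$ let $N_\theta(V)=\{x'\in C_1(\widetilde\Gamma,\widetilde H;\mathbb Q) : \langle x,x'\rangle>\theta\|x\|\|x'\|\text{ for some }x\in V\}$. For a set $N$ let $N^\infty$ be the set of all relative 1-chains $x'$ such that, for some $k\ge0$, $x'\in A^k(N)$ or $A^k(x')\in N$. Assume that $f$ satisfies the chain flare condition relative to $H$, with $\mathbb Q[\mathbb F]$-submodules $V_{\rm h},V_{\rm qf}\subseteq C_1(\widetilde\Gamma,\widetilde H;\mathbb Q)$. That is: 1. $C_1(\widetilde\Gamma,\widetilde H;\mathbb Q)=V_{\rm h}+V_{\rm qf}$; 2. there are $\lambda_0>1$ and $0<\theta<1$ with $\lambda_0\|A(x)\|\le\max\{\|A^2(x)\|,\|x\|\}$ for all $x\in N_\theta(V_{\rm h})^\infty$; 3. if $V_{\rm qf}\ne\{0\}$, there is a Nielsen 1-chain $\rho$ such that every $x\in V_{\rm qf}$ is a finite rational linear combination of translates $g\rho$, $g\in\mathbb F$. **The operator and the subspaces.** Let $G_\phi=\mathbb F\rtimes_{\Phi_f}\langle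 t\rangle=\langle\mathbb F,t\mid t^{-1}xt=\Phi_f(x)\ (x\in\mathbb F)\rangle$ and let $n_H$ be the number of edges of $\Gamma$ not in $H$. Choose a lift to $\widetilde\Gamma$ of each of these edges; these lifts form a basis of the free $\mathbb Q[\mathbb F]$-module $C_1(\widetilde\Gamma,\widetilde H;\mathbb Q)\cong\mathbb Q[\mathbb F]^{n_H}$. Let $J$ be the $n_H\times n_H$ matrix over the group ring of $\mathbb F$ whose rows are the coordinates of $A_{f,H}$ of the basis elements, and let $L_{f,H}$ be the bounded operator on $L^2(G_\phi)^{n_H}$ given by right multiplication by $tJ$. Let $V_{\rm qf}^{(2)}\subseteq L^2(\mathbb F)^{n_H}\subseteq L^2(G_\phi)^{n_H}$ be the closed complex span of $V_{\rm qf}$, and let $W_{\rm qf}^{(2)}$ be the closure of $\bigoplus_{\ell\in\mathbb Z}t^\ell V_{\rm qf}^{(2)}$ in $L^2(G_\phi)^{n_H}$. For a bounded operator $B$ on a Hilbert space $\mathcal H$ and $\nu>0$ let $$\mathfrak E(B,\nu)=\{\xi\in\mathcal H:\exists(\xi_j)\subset\mathcal H,\ \lim_{j\to\infty}\|\xi_j-\xi\|=0,\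 \limsup_{j\to\infty}\|B^j\xi_j\|^{1/j}\le\nu\},$$ $$\mathfrak F(B,\nu)=\{\xi\in\mathcal H:\exists(\xi_j)\subset\mathcal H,\ \lim_{j\to\infty}\|B^j\xi_j-\xi\|=0,\ \limsup_{j\to\infty}\|\xi_j\|^{1/j}\le\nu^{-1}\}.$$ **Theorem.** There is a constant $\lambda>1$ such that for every $1\le\nu<\lambda$ $$W_{\rm qf}^{(2)}=\mathfrak E(L_{f,H},\nu)\cap\mathfrak F(L_{f,H},\nu^{-1}).$$ -/

import Mathlib

open CategoryTheory Filter Topology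
open scoped ENNReal

universe u v

noncomputable section

namespace ChainFlare

/-! ### Graphs, cellular maps, homotopy equivalences

A graph is a quiver `V`: its points are the vertices and its arrows are the (oriented) edges.
Edge-paths may cross edges in both directions.
The fundamental groupoid of the graph is `Quiver.FreeGroupoid V`: its morphisms are the edge-paths
modulo insertion and deletion of backtracking, that is, modulo homotopy relative to endpoints. -/

section Graphs

variable (V : Type u) [Quiver.{v} V]

variable {V} in
/-- Edge-paths (possibly constant) from one vertex to another; the last edge is crossed either in its
own direction (`pos`) or in the opposite direction (`neg`). -/
inductive EdgePath : V → V → Type (max u v)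
  | nil (a : V) : EdgePath a a
  | pos {a b c : V} (p : EdgePath a b) (e : b ⟶ c) : EdgePath a c
  | neg {a b c : V} (p : EdgePath a b) (e : c ⟶ b) : EdgePath a c

/-- The graph is connected. -/
def IsConnectedGraph : Prop := ∀ a b : V, Nonempty (EdgePath a b)

variable {V}

/-- A vertex, as an object of the fundamental groupoid. -/
abbrev pt (a : V) : Quiver.FreeGroupoid V := (Quiver.FreeGroupoid.of V).obj a

/-- The homotopy class (rel endpoints) of an edge. -/
abbrev edgeClass {a b : V} (e : a ⟶ b) : pt a ⟶ pt b := (Quiver.FreeGroupoid.of V).map e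

/-- The homotopy class (rel endpoints) of an edge-path. -/
def EdgePath.homotopyClass {a : V} : {b : V} → EdgePath a b → (pt a ⟶ pt b)
  | _, .nil _ => 𝟙 _
  | _, .pos p e => EdgePath.homotopyClass p ≫ edgeClass e
  | _, .neg p e => EdgePath.homotopyClass p ≫ Groupoid.inv (edgeClass e)

/-- The number of edges of an edge-path. -/
def EdgePath.length {a : V} : {b : V} → EdgePath a b → ℕ
  | _, .nil _ => 0
  | _, .pos p _ => EdgePath.length p + 1
  | _, .neg p _ => EdgePath.length p + 1

/-- The edges (without their direction) crossed by an edge-path. -/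
def EdgePath.crossed {a : V} : {b : V} → EdgePath a b → Set (Quiver.Total V)
  | _, .nil _ => ∅
  | _, .pos p e => insert ⟨_, _, e⟩ (EdgePath.crossed p)
  | _, .neg p e => insert ⟨_, _, e⟩ (EdgePath.crossed p)

variable (V) in
/-- A cellular self-map of the graph: it maps vertices to vertices and each edge across an
edge-path, which may be constant. -/
structure CellularMap where
  vert : V → V
  path : {a b : V} → (a ⟶ b) → EdgePath (vert a) (vert b)

/-- The functor induced by a cellular map on the fundamental groupoid. -/
def CellularMap.functor (f : CellularMap V) : Quiver.FreeGroupoid V ⥤ Quiver.FreeGroupoid V :=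
  Quiver.FreeGroupoid.lift
    { obj := fun a => pt (f.vert a)
      map := fun e => (f.path e).homotopyClass }

/-- `f` is a homotopy equivalence: it has a homotopy inverse `g`, which is taken cellular.
A homotopy from `g ∘ f` to the identity is given by its tracks at the vertices: edge-paths
(up to homotopy rel endpoints) from `g (f a)` to `a`, such that the square over each edge can be
filled in; this is a natural isomorphism between the functors on the fundamental groupoid. -/
def CellularMap.IsHomotopyEquiv (f : CellularMap V) : Prop :=
  ∃ g : CellularMap V,
    Nonempty (f.functor ⋙ g.functor ≅ 𝟭 _) ∧ Nonempty (g.functor ⋙ f.functor ≅ 𝟭 _)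

variable (V) in
/-- A morphism `f : Γ → Γ` (each edge is expanded across a non-constant edge-path) which is a
homotopy equivalence and fixes a vertex `base`. -/
structure BasedHomotopyEquiv extends CellularMap V where
  length_pos : ∀ {a b : V} (e : a ⟶ b), 0 < (path e).length
  isHomotopyEquiv : toCellularMap.IsHomotopyEquiv
  base : V
  vert_base : vert base = base

variable (V) in
/-- A subgraph: a set of vertices and a set of edges that contains the endpoints of its edges. -/
structure Subgraph where
  verts : Set V
  edges : Set (Quiver.Total V)
  left_mem : ∀ e ∈ edges, e.left ∈ verts
  right_mem : ∀ e ∈ edges, e.right ∈ verts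

/-- `f(H) ⊆ H`. -/
def Subgraph.Invariant (H : Subgraph V) (f : CellularMap V) : Prop :=
  (∀ a ∈ H.verts, f.vert a ∈ H.verts) ∧
    ∀ e ∈ H.edges, (f.path e.hom).crossed ⊆ H.edges

/-- The edges of `Γ - H`. -/
abbrev Subgraph.CoEdge (H : Subgraph V) := {e : Quiver.Total V // e ∉ H.edges}

instance Subgraph.fintypeCoEdge [Finite (Quiver.Total V)] (H : Subgraph V) :
    Fintype H.CoEdge := Fintype.ofFinite _

end Graphs

/-! ### The fundamental group, the universal cover and the lift of `f` -/

section Cover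

variable {V : Type u} [Quiver.{v} V]

/-- The fundamental group `𝔽 = π₁(Γ, x₀)`; the product is concatenation of loops. -/
abbrev Pi1 (x₀ : V) := pt x₀ ⟶ pt x₀

/-- The vertices of the universal cover: homotopy classes of edge-paths in `Γ` that start at the
base vertex. The lift of the base vertex is the class of the constant path. -/
abbrev CoverVertex (x₀ : V) := Σ a : V, (pt x₀ ⟶ pt a)

/-- The edges of the universal cover: an edge `e` of `Γ` with a lift of its initial vertex. -/
abbrev CoverEdge (x₀ : V) := Σ e : Quiver.Total V, (pt x₀ ⟶ pt e.left)

/-- Initial vertex of an edge of the universal cover. -/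
def CoverEdge.o {x₀ : V} (e : CoverEdge x₀) : CoverVertex x₀ := ⟨e.1.left, e.2⟩

/-- Terminal vertex of an edge of the universal cover. -/
def CoverEdge.t {x₀ : V} (e : CoverEdge x₀) : CoverVertex x₀ :=
  ⟨e.1.right, e.2 ≫ edgeClass e.1.hom⟩

/-- The action of `𝔽` on the edges of the universal cover. -/
def CoverEdge.act {x₀ : V} (g : Pi1 x₀) (e : CoverEdge x₀) : CoverEdge x₀ := ⟨e.1, g ≫ e.2⟩

theorem CoverEdge.act_injective {x₀ : V} (g : Pi1 x₀) : Function.Injective (CoverEdge.act g) := by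
  rintro ⟨e, p⟩ ⟨e', p'⟩ h
  obtain ⟨rfl, h⟩ := Sigma.mk.inj_iff.1 h
  exact Sigma.ext rfl (heq_of_eq ((cancel_epi g).1 (eq_of_heq h)))

theorem CoverEdge.act_left_injective {x₀ : V} (e : CoverEdge x₀) :
    Function.Injective fun g : Pi1 x₀ => e.act g := by
  intro g k h
  exact (cancel_mono e.2).1 (eq_of_heq (Sigma.mk.inj_iff.1 h).2)

/-- The image of a morphism from `c` under a functor that fixes `c`. -/
def basedMap {C : Type*} [Groupoid C] (F : C ⥤ C) {c d : C} (h : F.obj c = c) (p : c ⟶ d) :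
    c ⟶ F.obj d :=
  eqToHom h.symm ≫ F.map p

/-- The endomorphism of the group of loops at `c` induced by a functor that fixes `c`. -/
def loopHom {C : Type*} [Groupoid C] (F : C ⥤ C) {c : C} (h : F.obj c = c) : (c ⟶ c) →* (c ⟶ c) where
  toFun g := eqToHom h.symm ≫ F.map g ≫ eqToHom h
  map_one' := by
    change eqToHom h.symm ≫ F.map (𝟙 c) ≫ eqToHom h = 𝟙 c
    simp
  map_mul' g k := by
    change eqToHom h.symm ≫ F.map (g ≫ k) ≫ eqToHom h =
      (eqToHom h.symm ≫ F.map g ≫ eqToHom h) ≫ eqToHom h.symm ≫ F.map k ≫ eqToHom h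
    simp

theorem loopHom_bijective {C : Type*} [Groupoid C] {F : C ⥤ C} (hF : F.FullyFaithful) {c : C}
    (h : F.obj c = c) : Function.Bijective (loopHom F h) := by
  constructor
  · intro g k hgk
    change eqToHom h.symm ≫ F.map g ≫ eqToHom h = eqToHom h.symm ≫ F.map k ≫ eqToHom h at hgk
    exact hF.map_injective ((cancel_mono (eqToHom h)).1 ((cancel_epi (eqToHom h.symm)).1 hgk))
  · intro g
    refine ⟨hF.preimage (eqToHom h ≫ g ≫ eqToHom h.symm), ?_⟩
    change eqToHom h.symm ≫ F.map _ ≫ eqToHom h = g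
    simp

namespace BasedHomotopyEquiv

variable (f : BasedHomotopyEquiv V)

/-- The image under `f` of the homotopy class of an edge-path that starts at the base vertex. -/
def onClass {a : V} (p : pt f.base ⟶ pt a) : pt f.base ⟶ pt (f.vert a) :=
  basedMap f.functor (congrArg pt f.vert_base) p

/-- The endomorphism `g ↦ f(g)` of the group of loops at the base vertex. -/
def PhiHom : Pi1 f.base →* Pi1 f.base :=
  loopHom f.functor (congrArg pt f.vert_base)

theorem PhiHom_bijective : Function.Bijective f.PhiHom := by
  obtain ⟨g, ⟨i⟩, ⟨j⟩⟩ := f.isHomotopyEquiv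
  exact loopHom_bijective (CategoryTheory.Equivalence.mk f.functor g.functor i.symm j).fullyFaithfulFunctor _

/-- The automorphism `Φ_f` of `𝔽` induced by `f` and the constant path at the base vertex. -/
def Phi : MulAut (Pi1 f.base) := MulEquiv.ofBijective f.PhiHom f.PhiHom_bijective

/-- The lift `f̃` of `f` that fixes the lift of the base vertex, on vertices. -/
def liftVertex (u : CoverVertex f.base) : CoverVertex f.base := ⟨f.vert u.1, f.onClass u.2⟩

end BasedHomotopyEquiv

end Cover

/-! ### Chains in the universal cover -/

section Chains

variable {V : Type u} [Quiver.{v} V]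

/-- Rational cellular 1-chains of the universal cover. -/
abbrev Chain₁ (x₀ : V) := CoverEdge x₀ →₀ ℚ

/-- Rational cellular 0-chains of the universal cover. -/
abbrev Chain₀ (x₀ : V) := CoverVertex x₀ →₀ ℚ

/-- The boundary map, `∂ e = t(e) - o(e)`. -/
def boundary (x₀ : V) : Chain₁ x₀ →ₗ[ℚ] Chain₀ x₀ :=
  Finsupp.linearCombination ℚ fun e => Finsupp.single e.t 1 - Finsupp.single e.o 1

/-- The action of `g ∈ 𝔽` on 1-chains. -/
def chainAct {x₀ : V} (g : Pi1 x₀) : Chain₁ x₀ →ₗ[ℚ] Chain₁ x₀ :=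
  Finsupp.lmapDomain ℚ ℚ (CoverEdge.act g)

/-- The 1-chain of the lift, with initial vertex `p`, of an edge-path of `Γ`. -/
def EdgePath.liftChain {x₀ a : V} (p : pt x₀ ⟶ pt a) : {b : V} → EdgePath a b → Chain₁ x₀
  | _, .nil _ => 0
  | _, .pos q e =>
      EdgePath.liftChain p q + Finsupp.single ⟨⟨_, _, e⟩, p ≫ EdgePath.homotopyClass q⟩ 1
  | _, .neg q e =>
      EdgePath.liftChain p q - Finsupp.single
        ⟨⟨_, _, e⟩, p ≫ EdgePath.homotopyClass q ≫ Groupoid.inv (edgeClass e)⟩ 1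

/-- The relative 1-chains `C₁(Γ̃, H̃; ℚ)`: the coefficients at the edges of `H̃` vanish. -/
def relChain (x₀ : V) (H : Subgraph V) : Submodule ℚ (Chain₁ x₀) where
  carrier := {x | ∀ e : CoverEdge x₀, e.1 ∈ H.edges → x e = 0}
  zero_mem' := fun _ _ => rfl
  add_mem' := fun {x y} hx hy e he => by
    rw [Finsupp.add_apply, hx e he, hy e he, add_zero]
  smul_mem' := fun c x hx e he => by
    rw [Finsupp.smul_apply, hx e he, smul_zero]

open Classical in
/-- The projection `π_H^⊥` of the 1-chains onto the relative 1-chains: the coefficients at the edges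
of `H̃` are replaced by zero. -/
def projRel (x₀ : V) (H : Subgraph V) : Chain₁ x₀ →ₗ[ℚ] relChain x₀ H where
  toFun x := ⟨x.filter fun e => e.1 ∉ H.edges, fun _ he =>
    Finsupp.filter_apply_neg _ _ (not_not.mpr he)⟩
  map_add' _ _ := Subtype.ext Finsupp.filter_add
  map_smul' _ _ := Subtype.ext Finsupp.filter_smul

theorem chainAct_mem_relChain {x₀ : V} (H : Subgraph V) (g : Pi1 x₀) {x : Chain₁ x₀}
    (hx : x ∈ relChain x₀ H) : chainAct g x ∈ relChain x₀ H := by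
  intro e he
  have h : e = CoverEdge.act g ⟨e.1, Groupoid.inv g ≫ e.2⟩ :=
    Sigma.ext rfl (heq_of_eq (by
      change e.2 = g ≫ Groupoid.inv g ≫ e.2
      rw [← Category.assoc, Groupoid.comp_inv, Category.id_comp]))
  rw [h]
  exact (Finsupp.mapDomain_apply (CoverEdge.act_injective g) x _).trans (hx _ he)

/-- The action of `g ∈ 𝔽` on relative 1-chains. -/
def relAct {x₀ : V} (H : Subgraph V) (g : Pi1 x₀) : relChain x₀ H →ₗ[ℚ] relChain x₀ H :=
  (chainAct g).restrict fun _ hx => chainAct_mem_relChain H g hx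

/-- The rational subspace `W` of the relative 1-chains is a `ℚ[𝔽]`-submodule. -/
def IsPi1Stable {x₀ : V} {H : Subgraph V} (W : Submodule ℚ (relChain x₀ H)) : Prop :=
  ∀ g : Pi1 x₀, ∀ x ∈ W, relAct H g x ∈ W

/-- The inner product `∑ x_e y_e` of 1-chains. -/
def chainInner {x₀ : V} (x y : Chain₁ x₀) : ℝ := x.sum fun e a => (a : ℝ) * (y e : ℝ)

/-- The `L²`-norm of a 1-chain. -/
def chainNorm {x₀ : V} (x : Chain₁ x₀) : ℝ := Real.sqrt (chainInner x x)

namespace BasedHomotopyEquiv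

variable (f : BasedHomotopyEquiv V) (H : Subgraph V)

/-- The map `A_f` induced by `f̃` on 1-chains: the edge of the universal cover over `e` with initial
vertex `p` is mapped to the chain of the lift of `f(e)` with initial vertex `f̃(p)`. -/
def A : Chain₁ f.base →ₗ[ℚ] Chain₁ f.base :=
  Finsupp.linearCombination ℚ fun e => EdgePath.liftChain (f.onClass e.2) (f.path e.1.hom)

/-- The map `A_{f,H}` on relative 1-chains. -/
def ARel : relChain f.base H →ₗ[ℚ] relChain f.base H :=
  projRel f.base H ∘ₗ f.A ∘ₗ (relChain f.base H).subtype

/-- The set of edges in the support of `g ρ`. -/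
def suppAct (g : Pi1 f.base) (ρ : Chain₁ f.base) : Set (CoverEdge f.base) :=
  ((chainAct g ρ).support : Set (CoverEdge f.base))

/-- `ρ = π_H^⊥([u, v])` for distinct vertices `u`, `v` that are fixed by `f̃`, where `[u, v]` is the
1-chain with boundary `v - u`. -/
def IsFixedSegment (ρ : relChain f.base H) : Prop :=
  ∃ u v : CoverVertex f.base, u ≠ v ∧ f.liftVertex u = u ∧ f.liftVertex v = v ∧
    ∃ c : Chain₁ f.base,
      boundary f.base c = Finsupp.single v 1 - Finsupp.single u 1 ∧ ρ = projRel f.base H c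

/-- The condition that makes `ρ` non-geometric. -/
def NonGeometric (ρ : Chain₁ f.base) : Prop :=
  ∃ e : CoverEdge f.base, e.1 ∉ H.edges ∧ (ρ e = 1 ∨ ρ e = -1) ∧
    ∀ g : Pi1 f.base, g ≠ 1 → ρ (e.act g) = 0

/-- The conditions that make `ρ` geometric. -/
structure Geometric (ρ : Chain₁ f.base) : Prop where
  single : ∀ g₁ g₂ : Pi1 f.base, g₁ ≠ g₂ →
    f.suppAct g₁ ρ ∩ f.suppAct g₂ ρ = ∅ ∨ ∃ e, f.suppAct g₁ ρ ∩ f.suppAct g₂ ρ = {e}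
  pair : ∀ e : CoverEdge f.base, e.1 ∉ H.edges →
    ∃ g₁ g₂ : Pi1 f.base, g₁ ≠ g₂ ∧ f.suppAct g₁ ρ ∩ f.suppAct g₂ ρ = {e} ∧
      ∀ h₁ h₂ : Pi1 f.base, h₁ ≠ h₂ → f.suppAct h₁ ρ ∩ f.suppAct h₂ ρ = {e} →
        (h₁ = g₁ ∧ h₂ = g₂) ∨ (h₁ = g₂ ∧ h₂ = g₁)
  noncommuting : ∃ g₁ g₂ : Pi1 f.base, g₁ * g₂ ≠ g₂ * g₁ ∧
    (f.suppAct 1 ρ ∩ f.suppAct g₁ ρ).Nonempty ∧ (f.suppAct 1 ρ ∩ f.suppAct g₂ ρ).Nonempty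

/-- Nielsen 1-chains. -/
def IsNielsen (ρ : relChain f.base H) : Prop :=
  f.IsFixedSegment H ρ ∧ (f.NonGeometric H ρ ∨ f.Geometric H ρ)

/-- The chains that make a small angle with an element of `W`. -/
def angleNhd {x₀ : V} {H : Subgraph V} (θ : ℝ) (W : Submodule ℚ (relChain x₀ H)) :
    Set (relChain x₀ H) :=
  {x' | ∃ x ∈ W, θ * chainNorm (x : Chain₁ x₀) * chainNorm (x' : Chain₁ x₀) <
    chainInner (x : Chain₁ x₀) (x' : Chain₁ x₀)}

/-- `N^∞`, the union of the images and of the preimages of `N` under the iterates of `A_{f,H}`. -/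
def saturate (N : Set (relChain f.base H)) : Set (relChain f.base H) :=
  {x' | ∃ k : ℕ, (∃ x ∈ N, x' = (f.ARel H ^ k) x) ∨ (f.ARel H ^ k) x' ∈ N}

/-- `f` satisfies the chain flare condition relative to `H`, with hyperbolic submodule `Vh` and
quasi-fixed submodule `Vqf`. -/
structure ChainFlareCondition (Vh Vqf : Submodule ℚ (relChain f.base H)) : Prop where
  stable_h : IsPi1Stable Vh
  stable_qf : IsPi1Stable Vqf
  sup_eq_top : Vh ⊔ Vqf = ⊤
  flare : ∃ lam θ : ℝ, 1 < lam ∧ 0 < θ ∧ θ < 1 ∧ ∀ x ∈ f.saturate H (angleNhd θ Vh),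
    lam * chainNorm (f.ARel H x : Chain₁ f.base) ≤
      max (chainNorm (f.ARel H (f.ARel H x) : Chain₁ f.base)) (chainNorm (x : Chain₁ f.base))
  generated : Vqf ≠ ⊥ → ∃ ρ : relChain f.base H, f.IsNielsen H ρ ∧
    ∀ x ∈ Vqf, ∃ q : Pi1 f.base →₀ ℚ, x = q.sum fun g c => c • relAct H g ρ

end BasedHomotopyEquiv

end Chains

/-! ### `L²` of a group -/

section L2

open scoped lp

/-- `L²(G)`. -/
abbrev L2 (G : Type*) := ℓ²(G, ℂ)

/-- `L²(G)^n` with coordinates indexed by `n`. -/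
abbrev L2n (n G : Type*) [Fintype n] := PiLp 2 fun _ : n => L2 G

theorem norm_extend_rpow {α β : Type*} (i : α ↪ β) (ξ : α → ℂ) (b : β) (hb : b ∉ Set.range i) :
    ‖Function.extend i ξ 0 b‖ ^ (2 : ℝ≥0∞).toReal = 0 := by
  rw [Function.extend_apply' _ _ _ hb]
  simp

theorem memℓp_extend {α β : Type*} (i : α ↪ β) {ξ : α → ℂ} (hξ : Memℓp ξ 2) :
    Memℓp (Function.extend i ξ 0 : β → ℂ) 2 := by
  refine memℓp_gen ((i.injective.summable_iff fun b hb => norm_extend_rpow i ξ b hb).1 ?_)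
  refine (hξ.summable (by norm_num)).congr fun a => ?_
  simp [i.injective.extend_apply]

/-- The isometric embedding `∑ ξ_a a ↦ ∑ ξ_a i(a)` of `L²(α)` into `L²(β)` induced by an injective
map `i : α → β`. -/
def l2Map {α β : Type*} (i : α ↪ β) : L2 α →ₗᵢ[ℂ] L2 β where
  toFun ξ := ⟨Function.extend i ξ 0, memℓp_extend i ξ.2⟩
  map_add' ξ η := by
    refine lp.ext (funext fun b => ?_)
    by_cases hb : ∃ a, i a = b
    · obtain ⟨a, rfl⟩ := hb
      change Function.extend i (ξ + η : α → ℂ) 0 (i a) =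
        Function.extend i ξ 0 (i a) + Function.extend i η 0 (i a)
      simp only [i.injective.extend_apply, Pi.add_apply]
    · change Function.extend i (ξ + η : α → ℂ) 0 b =
        Function.extend i ξ 0 b + Function.extend i η 0 b
      simp only [Function.extend_apply' _ _ _ hb, Pi.zero_apply, add_zero]
  map_smul' c ξ := by
    refine lp.ext (funext fun b => ?_)
    by_cases hb : ∃ a, i a = b
    · obtain ⟨a, rfl⟩ := hb
      simp [i.injective.extend_apply]
    · simp [Function.extend_apply' _ _ _ hb]
  norm_map' ξ := by
    rw [lp.norm_eq_tsum_rpow (by norm_num), lp.norm_eq_tsum_rpow (by norm_num)]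
    congr 1
    have h : Function.support (fun b => ‖Function.extend i ξ 0 b‖ ^ (2 : ℝ≥0∞).toReal) ⊆
        Set.range i := fun b hb => by
      by_contra hb'
      exact hb (norm_extend_rpow i (ξ : α → ℂ) b hb')
    refine (i.injective.tsum_eq h).symm.trans (tsum_congr fun a => ?_)
    rw [i.injective.extend_apply]

/-- `l2Map i` in each coordinate. -/
def l2nMap (n : Type*) [Fintype n] {α β : Type*} (i : α ↪ β) : L2n n α →L[ℂ] L2n n β :=
  (PiLp.continuousLinearEquiv 2 ℂ fun _ : n => L2 β).symm.toContinuousLinearMap ∘L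
    ContinuousLinearMap.pi fun j =>
      (l2Map i).toContinuousLinearMap ∘L PiLp.proj 2 (fun _ : n => L2 α) j

/-- Right multiplication `ξ ↦ ξ · x` by an element `x` of the group algebra, on `L²(G)`. -/
def rightMul {G : Type*} [Group G] (x : MonoidAlgebra ℂ G) : L2 G →L[ℂ] L2 G :=
  x.coeff.sum fun g c => c • (l2Map (mulRightEmbedding g)).toContinuousLinearMap

/-- Right multiplication of row vectors by a matrix over the group algebra, on `L²(G)^n`. -/
def rightMulMatrix {n G : Type*} [Fintype n] [Group G] (M : Matrix n n (MonoidAlgebra ℂ G)) :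
    L2n n G →L[ℂ] L2n n G :=
  (PiLp.continuousLinearEquiv 2 ℂ fun _ : n => L2 G).symm.toContinuousLinearMap ∘L
    ContinuousLinearMap.pi fun j =>
      ∑ i, rightMul (M i j) ∘L PiLp.proj 2 (fun _ : n => L2 G) i

end L2

/-! ### Haagerup–Schultz subspaces

The `limsup`s are taken in `[0, ∞]`. -/

section HaagerupSchultz

variable {E : Type*} [NormedAddCommGroup E] [NormedSpace ℂ E]

/-- The subspace `𝔈(A, ν)`. -/
def hsE (A : E →L[ℂ] E) (ν : ℝ) : Set E :=
  {ξ | ∃ s : ℕ → E, Tendsto (fun j => ‖s j - ξ‖) atTop (𝓝 0) ∧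
    limsup (fun j : ℕ => ‖(A ^ j) (s j)‖ₑ ^ (1 / (j : ℝ))) atTop ≤ ENNReal.ofReal ν}

/-- The subspace `𝔉(A, ν)`. -/
def hsF (A : E →L[ℂ] E) (ν : ℝ) : Set E :=
  {ξ | ∃ s : ℕ → E, Tendsto (fun j => ‖(A ^ j) (s j) - ξ‖) atTop (𝓝 0) ∧
    limsup (fun j : ℕ => ‖s j‖ₑ ^ (1 / (j : ℝ))) atTop ≤ ENNReal.ofReal ν⁻¹}

end HaagerupSchultz

/-! ### The free-by-cyclic group, the operator `L_{f,H}` and the induced quasi-fixed subspace -/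

namespace BasedHomotopyEquiv

variable {V : Type u} [Quiver.{v} V] (f : BasedHomotopyEquiv V)

/-- The free-by-cyclic group `G_φ = 𝔽 ⋊ ⟨t⟩ = ⟨𝔽, t ∣ t⁻¹ x t = Φ_f(x)⟩`. -/
abbrev FreeByCyclic :=
  Pi1 f.base ⋊[zpowersHom (MulAut (Pi1 f.base)) f.Phi⁻¹] Multiplicative ℤ

/-- The stable letter `t`. -/
def t : f.FreeByCyclic := SemidirectProduct.inr (Multiplicative.ofAdd 1)

/-- The inclusion of `𝔽`. -/
def incl : Pi1 f.base →* f.FreeByCyclic := SemidirectProduct.inl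

/-- Conjugation by the stable letter induces `Φ_f`. -/
theorem t_inv_mul_incl_mul_t (x : Pi1 f.base) : f.t⁻¹ * f.incl x * f.t = f.incl (f.Phi x) := by
  have h : f.t * f.incl (f.Phi x) * f.t⁻¹ = f.incl x := by
    have h' := SemidirectProduct.inl_aut (φ := zpowersHom (MulAut (Pi1 f.base)) f.Phi⁻¹)
      (Multiplicative.ofAdd 1) (f.Phi x)
    change _ = SemidirectProduct.inr _ * SemidirectProduct.inl _ * SemidirectProduct.inr _ at h'
    change SemidirectProduct.inr _ * SemidirectProduct.inl _ * (SemidirectProduct.inr _)⁻¹ = _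
    rw [← MonoidHom.map_inv]
    refine h'.symm.trans (congrArg (fun y => SemidirectProduct.inl y) ?_)
    simp
  rw [← h]
  group

variable (H : Subgraph V)

/-- A basis of the `ℚ[𝔽]`-module `C₁(Γ̃, H̃; ℚ)`: a lift of each edge of `Γ - H`, given by a lift of
its initial vertex. -/
abbrev EdgeLifts := (e : H.CoEdge) → (pt f.base ⟶ pt e.1.left)

variable {H}

/-- The chosen lift of an edge of `Γ - H`. -/
def EdgeLifts.edge {f : BasedHomotopyEquiv V} {H : Subgraph V} (b : f.EdgeLifts H) (e : H.CoEdge) :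
    CoverEdge f.base := ⟨e.1, b e⟩

/-- The coordinate in `ℚ[𝔽]` of a 1-chain at the basis element `e`: the coefficient at `g ∈ 𝔽` is the
coefficient of the chain at the edge `g e`. -/
def EdgeLifts.coord {f : BasedHomotopyEquiv V} {H : Subgraph V} (b : f.EdgeLifts H)
    (x : Chain₁ f.base) (e : H.CoEdge) : Pi1 f.base →₀ ℚ :=
  x.comapDomain (fun g => (b.edge e).act g) ((b.edge e).act_left_injective.injOn)

variable [Finite (Quiver.Total V)]

/-- The matrix `t J₁(f)_H` over the group ring of `G_φ`: the row at `e` records the coordinates of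
`A_f(e)`. -/
def tJacobian (b : f.EdgeLifts H) : Matrix H.CoEdge H.CoEdge (MonoidAlgebra ℂ f.FreeByCyclic) :=
  fun e e' => (b.coord (f.A (Finsupp.single (b.edge e) 1)) e').sum fun g q =>
    MonoidAlgebra.single (f.t * f.incl g) (q : ℂ)

/-- The operator `L_{f,H}` on `L²(G_φ)^{n_H}`, right multiplication by `t J₁(f)_H`. -/
def L (b : f.EdgeLifts H) : L2n H.CoEdge f.FreeByCyclic →L[ℂ] L2n H.CoEdge f.FreeByCyclic :=
  rightMulMatrix (f.tJacobian b)

/-- A relative 1-chain as an element of `L²(𝔽)^{n_H}`. -/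
def EdgeLifts.toL2 {f : BasedHomotopyEquiv V} {H : Subgraph V} (b : f.EdgeLifts H)
    (x : Chain₁ f.base) : L2n H.CoEdge (Pi1 f.base) :=
  WithLp.toLp 2 fun e => ⟨fun g => ((b.coord x e g : ℚ) : ℂ),
    (memℓp_zero ((b.coord x e).hasFiniteSupport.subset fun g hg h =>
      hg (by simp [h]))).of_exponent_ge zero_le⟩

/-- The Hilbert `𝔽`-module `W^{(2)} = L²(𝔽) ⊗_{ℚ[𝔽]} W` as a submodule of `L²(𝔽)^{n_H}`: the closed
complex span of `W`. -/
def L2Completion (b : f.EdgeLifts H) (W : Submodule ℚ (relChain f.base H)) :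
    Submodule ℂ (L2n H.CoEdge (Pi1 f.base)) :=
  (Submodule.span ℂ ((fun x : relChain f.base H => b.toL2 (x : Chain₁ f.base)) '' W)).topologicalClosure

/-- The embedding `g ↦ t^l g` of `𝔽` into `G_φ`. -/
def cosetEmbedding (l : ℤ) : Pi1 f.base ↪ f.FreeByCyclic where
  toFun g := f.t ^ l * f.incl g
  inj' _ _ hgh := SemidirectProduct.inl_injective (mul_left_cancel hgh)

/-- The induced module: the closure of `⨁_l t^l W^{(2)}` in `L²(G_φ)^{n_H}`. For the quasi-fixed
submodule `W = V_qf` this is `W_qf^{(2)}`. -/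
def inducedL2 (b : f.EdgeLifts H) (W : Submodule ℚ (relChain f.base H)) :
    Submodule ℂ (L2n H.CoEdge f.FreeByCyclic) :=
  (⨆ l : ℤ, (f.L2Completion b W).map
    (l2nMap H.CoEdge (f.cosetEmbedding l)).toLinearMap).topologicalClosure

end BasedHomotopyEquiv

end ChainFlare

end

/-!
A Nielsen 1-chain `ρ` is fixed by `A_{f,H}`, because `[u, v]` is the only 1-chain with boundary
`v - u` on the tree `Γ̃`. The operator `L_{f,H}` thus takes each translate `γρ`, `γ ∈ G_φ`, to the
translate `γtρ`, which has the same norm. This puts `W_qf^{(2)}` into both subspaces.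

Conversely `V_h` and `V_qf` together induce all of `L²(G_φ)^{n_H}`, so it suffices to show that a
vector `ξ` in the module induced by `V_h` and in both subspaces is zero. Since chains are rational,
`ξ` is tested through the real part `ω` of its component on a coset `t^l 𝔽`, which is a limit of
chains in `V_h`. If `ω ≠ 0`, the chains close to `ω` make a small angle with `V_h`, so their orbits
flare, forwards and backwards. A flaring orbit that does not decrease at the first step grows
exponentially at the rate `λ`, and one that does not increase by the factor `λ` at some step has
decayed exponentially before it. The approximations of `ω` that `𝔈` provides grow at most like
`ν^j` with `ν < λ`, hence `‖Lω‖ ≤ ‖ω‖`; those that `𝔉` provides give `λ‖ω‖ ≤ ‖Lω‖`. So `ω = 0`.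
-/

noncomputable section

namespace ChainFlare

section UniversalCover

variable {V : Type u} [Quiver.{v} V]

theorem lift_edgeClass {C : Type*} [Groupoid C] (φ : V ⥤q C) {a b : V} (e : a ⟶ b) :
    (Quiver.FreeGroupoid.lift φ).map (edgeClass e) = φ.map e :=
  Category.id_comp _

/-- Transport across the edge `e` of chain-valued functions on the fibre of the universal cover:
a value is carried to the other end of the lift of `e`, and the lift is added to it. -/
def edgeTransport (x₀ : V) {a b : V} (e : a ⟶ b) :
    ((pt x₀ ⟶ pt a) → Chain₁ x₀) ≃ ((pt x₀ ⟶ pt b) → Chain₁ x₀) where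
  toFun F q := F (q ≫ Groupoid.inv (edgeClass e)) +
    Finsupp.single ⟨⟨_, _, e⟩, q ≫ Groupoid.inv (edgeClass e)⟩ 1
  invFun F p := F (p ≫ edgeClass e) - Finsupp.single ⟨⟨_, _, e⟩, p⟩ 1
  left_inv F := by simp
  right_inv F := by simp

/-- The functor that transports chain-valued functions on the fibres of the universal cover along
homotopy classes of edge-paths. -/
def chainTransport (x₀ : V) : Quiver.FreeGroupoid V ⥤ Core (Type (max u v)) :=
  Quiver.FreeGroupoid.lift
    { obj := fun a => ⟨(pt x₀ ⟶ pt a) → Chain₁ x₀⟩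
      map := fun e => ⟨(edgeTransport x₀ e).toIso⟩ }

/-- The 1-chain `[x₀, u]` of the universal cover, from the lift of the base vertex to `u`. -/
def segment {x₀ : V} (u : CoverVertex x₀) : Chain₁ x₀ :=
  ((chainTransport x₀).map u.2).iso.hom (fun _ => 0) u.2

theorem segment_terminal {x₀ : V} (e : CoverEdge x₀) :
    segment e.t = segment e.o + Finsupp.single e 1 := by
  obtain ⟨⟨a, b, e⟩, p⟩ := e
  have hmap : (chainTransport x₀).map (p ≫ edgeClass e) =
      (chainTransport x₀).map p ≫ ⟨(edgeTransport x₀ e).toIso⟩ := by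
    rw [Functor.map_comp]
    exact congrArg _ (lift_edgeClass _ e)
  change ((chainTransport x₀).map (p ≫ edgeClass e)).iso.hom (fun _ => 0) (p ≫ edgeClass e) = _
  have hp : (p ≫ edgeClass e) ≫ Groupoid.inv (edgeClass e) = p := by simp
  rw [hmap]
  exact congrArg (fun q => ((chainTransport x₀).map p).iso.hom (fun _ => 0) q +
    Finsupp.single ⟨⟨a, b, e⟩, q⟩ 1) hp

-- Since the universal cover is a tree, `u ↦ [x₀, u]` extends to a left inverse of the boundary.
theorem boundary_injective (x₀ : V) : Function.Injective (boundary x₀) := by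
  have hinv : Finsupp.linearCombination ℚ (segment (x₀ := x₀)) ∘ₗ boundary x₀ = LinearMap.id := by
    ext e : 2
    simp [boundary, segment_terminal]
  have hleft : Function.LeftInverse (Finsupp.linearCombination ℚ segment) (boundary x₀) :=
    LinearMap.congr_fun hinv
  exact hleft.injective

theorem boundary_single {x₀ : V} (e : CoverEdge x₀) :
    boundary x₀ (Finsupp.single e 1) = Finsupp.single e.t 1 - Finsupp.single e.o 1 := by
  simp [boundary]

theorem boundary_liftChain {x₀ a b : V} (p : pt x₀ ⟶ pt a) (q : EdgePath a b) :
    boundary x₀ (q.liftChain p) =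
      Finsupp.single (⟨b, p ≫ q.homotopyClass⟩ : CoverVertex x₀) 1 -
        Finsupp.single (⟨a, p⟩ : CoverVertex x₀) 1 := by
  induction q with
  | nil => simp [EdgePath.liftChain, EdgePath.homotopyClass]
  | pos q e ih =>
    simp [EdgePath.liftChain, EdgePath.homotopyClass, ih, boundary_single, CoverEdge.t, CoverEdge.o]
  | neg q e ih =>
    simp [EdgePath.liftChain, EdgePath.homotopyClass, ih, boundary_single, CoverEdge.t, CoverEdge.o]

theorem chainAct_single {x₀ : V} (g : Pi1 x₀) (e : CoverEdge x₀) (c : ℚ) :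
    chainAct g (Finsupp.single e c) = Finsupp.single (e.act g) c :=
  Finsupp.mapDomain_single

theorem liftChain_act {x₀ a b : V} (g : Pi1 x₀) (p : pt x₀ ⟶ pt a) (q : EdgePath a b) :
    q.liftChain (g ≫ p) = chainAct g (q.liftChain p) := by
  induction q with
  | nil => simp [EdgePath.liftChain]
  | pos q e ih => simp [EdgePath.liftChain, ih, chainAct_single, CoverEdge.act]
  | neg q e ih => simp [EdgePath.liftChain, ih, chainAct_single, CoverEdge.act]

theorem liftChain_apply_eq_zero {x₀ a b : V} (p : pt x₀ ⟶ pt a) (q : EdgePath a b)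
    {e : CoverEdge x₀} (he : e.1 ∉ q.crossed) : q.liftChain p e = 0 := by
  induction q with
  | nil => rfl
  | pos q e' ih =>
    obtain ⟨hne, hq⟩ := not_or.1 he
    rw [EdgePath.liftChain, Finsupp.add_apply, ih hq, zero_add]
    exact Finsupp.single_eq_of_ne fun h => hne (congrArg Sigma.fst h)
  | neg q e' ih =>
    obtain ⟨hne, hq⟩ := not_or.1 he
    rw [EdgePath.liftChain, Finsupp.sub_apply, ih hq, zero_sub, neg_eq_zero]
    exact Finsupp.single_eq_of_ne fun h => hne (congrArg Sigma.fst h)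

end UniversalCover

section RelativeChains

variable {V : Type u} [Quiver.{v} V] {x₀ : V} {H : Subgraph V}

theorem projRel_eq_zero {x : Chain₁ x₀} (hx : ∀ e : CoverEdge x₀, e.1 ∉ H.edges → x e = 0) :
    projRel x₀ H x = 0 := by
  classical exact Subtype.ext ((Finsupp.filter_eq_zero_iff _ _).2 hx)

theorem coe_projRel_single {e : CoverEdge x₀} (he : e.1 ∉ H.edges) (c : ℚ) :
    (projRel x₀ H (Finsupp.single e c) : Chain₁ x₀) = Finsupp.single e c := by
  classical exact Finsupp.filter_single_of_pos _ he

theorem projRel_single_eq_zero {e : CoverEdge x₀} (he : e.1 ∈ H.edges) (c : ℚ) :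
    projRel x₀ H (Finsupp.single e c) = 0 := by
  classical exact Subtype.ext (Finsupp.filter_single_of_neg _ (not_not.2 he))

end RelativeChains

theorem basedMap_comp {C : Type*} [Groupoid C] (F : C ⥤ C) {c d d' : C} (h : F.obj c = c)
    (p : c ⟶ d) (q : d ⟶ d') : basedMap F h (p ≫ q) = basedMap F h p ≫ F.map q := by
  simp [basedMap]

theorem basedMap_loop_comp {C : Type*} [Groupoid C] (F : C ⥤ C) {c d : C} (h : F.obj c = c)
    (g : c ⟶ c) (p : c ⟶ d) : basedMap F h (g ≫ p) = loopHom F h g ≫ basedMap F h p := by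
  change eqToHom _ ≫ F.map _ = (eqToHom _ ≫ F.map g ≫ eqToHom _) ≫ eqToHom _ ≫ F.map p
  simp

namespace BasedHomotopyEquiv

section ChainMap

variable {V : Type u} [Quiver.{v} V] (f : BasedHomotopyEquiv V)

theorem onClass_comp_edgeClass {a b : V} (p : pt f.base ⟶ pt a) (e : a ⟶ b) :
    f.onClass (p ≫ edgeClass e) = f.onClass p ≫ (f.path e).homotopyClass :=
  (basedMap_comp _ _ _ _).trans (congrArg (f.onClass p ≫ ·) (lift_edgeClass _ e))

theorem onClass_loop_comp {a : V} (g : Pi1 f.base) (p : pt f.base ⟶ pt a) :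
    f.onClass (g ≫ p) = (show Pi1 f.base from f.Phi g) ≫ f.onClass p :=
  basedMap_loop_comp _ _ _ _

theorem A_single (e : CoverEdge f.base) :
    f.A (Finsupp.single e 1) = (f.path e.1.hom).liftChain (f.onClass e.2) := by
  simp [A]

theorem A_chainAct (g : Pi1 f.base) (x : Chain₁ f.base) :
    f.A (chainAct g x) = chainAct (f.Phi g) (f.A x) := by
  have h : f.A ∘ₗ chainAct g = chainAct (f.Phi g) ∘ₗ f.A := by
    ext e : 2
    simp only [LinearMap.comp_apply, Finsupp.lsingle_apply, chainAct_single, A_single]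
    rw [← liftChain_act]
    exact congrArg (EdgePath.liftChain · (f.path e.1.hom)) (f.onClass_loop_comp g e.2)
  exact LinearMap.congr_fun h x

theorem boundary_A (x : Chain₁ f.base) :
    boundary f.base (f.A x) = Finsupp.lmapDomain ℚ ℚ f.liftVertex (boundary f.base x) := by
  have h : boundary f.base ∘ₗ f.A = Finsupp.lmapDomain ℚ ℚ f.liftVertex ∘ₗ boundary f.base := by
    ext e : 2
    obtain ⟨⟨a, b, e⟩, p⟩ := e
    simp only [LinearMap.comp_apply, Finsupp.lsingle_apply, A_single, boundary_liftChain,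
      ← onClass_comp_edgeClass, boundary_single, map_sub, Finsupp.lmapDomain_apply,
      Finsupp.mapDomain_single]
    rfl
  exact LinearMap.congr_fun h x

variable {f} {H : Subgraph V}

theorem A_eq_self_of_boundary_eq {u v : CoverVertex f.base} (hu : f.liftVertex u = u)
    (hv : f.liftVertex v = v) {c : Chain₁ f.base}
    (hc : boundary f.base c = Finsupp.single v 1 - Finsupp.single u 1) : f.A c = c := by
  apply boundary_injective
  rw [boundary_A, hc, map_sub, Finsupp.lmapDomain_apply, Finsupp.lmapDomain_apply,
    Finsupp.mapDomain_single, Finsupp.mapDomain_single, hu, hv]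

theorem projRel_A_projRel (hH : H.Invariant f.toCellularMap) (x : Chain₁ f.base) :
    projRel f.base H (f.A (projRel f.base H x)) = projRel f.base H (f.A x) := by
  have h : projRel f.base H ∘ₗ f.A ∘ₗ (relChain f.base H).subtype ∘ₗ projRel f.base H =
      projRel f.base H ∘ₗ f.A := by
    ext e : 2
    simp only [LinearMap.comp_apply, Finsupp.lsingle_apply, Submodule.subtype_apply]
    by_cases he : e.1 ∈ H.edges
    · have hcrossed : projRel f.base H (f.A (Finsupp.single e 1)) = 0 :=
        projRel_eq_zero fun e' he' => by
          rw [A_single]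
          exact liftChain_apply_eq_zero _ _ fun h => he' (hH.2 _ he h)
      rw [projRel_single_eq_zero he, hcrossed, ZeroMemClass.coe_zero, map_zero, map_zero]
    · rw [coe_projRel_single he]
  exact LinearMap.congr_fun h x

theorem IsFixedSegment.ARel_eq_self (hH : H.Invariant f.toCellularMap) {ρ : relChain f.base H}
    (hρ : f.IsFixedSegment H ρ) : f.ARel H ρ = ρ := by
  obtain ⟨u, v, -, hu, hv, c, hc, rfl⟩ := hρ
  exact (projRel_A_projRel hH c).trans (congrArg _ (A_eq_self_of_boundary_eq hu hv hc))

variable (f H)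

/-- The span of the translates of the relative chains that are fixed by `A_{f,H}`. -/
def quasiFixed : Submodule ℚ (relChain f.base H) :=
  Submodule.span ℚ {x | ∃ g ρ, f.ARel H ρ = ρ ∧ x = relAct H g ρ}

variable {f H}

theorem ChainFlareCondition.le_quasiFixed (hH : H.Invariant f.toCellularMap)
    {Vh Vqf : Submodule ℚ (relChain f.base H)} (hflare : f.ChainFlareCondition H Vh Vqf) :
    Vqf ≤ f.quasiFixed H := by
  intro x hx
  rcases eq_or_ne Vqf ⊥ with rfl | hne
  · rw [(Submodule.mem_bot ℚ).1 hx]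
    exact zero_mem _
  · obtain ⟨ρ, hρ, hgen⟩ := hflare.generated hne
    obtain ⟨q, rfl⟩ := hgen x hx
    exact Submodule.sum_mem _ fun g _ => Submodule.smul_mem _ _ <|
      Submodule.subset_span ⟨g, ρ, hρ.1.ARel_eq_self hH, rfl⟩

end ChainMap

end BasedHomotopyEquiv

theorem mem_topologicalClosure_span_induction {R E : Type*} [Semiring R] [AddCommMonoid E]
    [Module R E] [TopologicalSpace E] [ContinuousAdd E] [ContinuousConstSMul R E] {s : Set E}
    {p : E → Prop} (closed : IsClosed {ξ | p ξ}) (zero : p 0)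
    (add : ∀ ξ η, p ξ → p η → p (ξ + η)) (smul_mem : ∀ (c : R), ∀ ξ ∈ s, p (c • ξ)) {ξ : E}
    (hξ : ξ ∈ (Submodule.span R s).topologicalClosure) : p ξ :=
  closure_minimal (fun _ hη => Submodule.closure_induction zero (fun η ζ _ _ => add η ζ)
    (fun c η h => smul_mem c η h) hη) closed hξ

section L2

open scoped lp InnerProductSpace

variable {n G α β : Type*} [Fintype n]

theorem L2n.ext {ξ η : L2n n α} (h : ∀ e a, ξ e a = η e a) : ξ = η :=
  PiLp.ext fun e => lp.ext (funext (h e))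

open Classical in
/-- The standard orthonormal basis of `L²(α)^n`. -/
def basisVec (e : n) (a : α) : L2n n α := WithLp.toLp 2 (Pi.single e (lp.single 2 a 1))

open Classical in
theorem basisVec_apply (e e' : n) (a a' : α) :
    basisVec e a e' a' = if e' = e ∧ a' = a then 1 else 0 := by
  by_cases h : e' = e
  · subst h
    simp [basisVec, Pi.single_apply]
  · simp [basisVec, h]

theorem inner_basisVec (e : n) (a : α) (ξ : L2n n α) : ⟪basisVec e a, ξ⟫_ℂ = ξ e a := by
  classical
  rw [PiLp.inner_apply, Finset.sum_eq_single e]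
  · simp [basisVec, lp.inner_single_left]
  · intro e' _ h
    simp [basisVec, h]
  · simp

theorem topologicalClosure_span_basisVec :
    (Submodule.span ℂ {ξ : L2n n α | ∃ e a, ξ = basisVec e a}).topologicalClosure = ⊤ := by
  refine Submodule.topologicalClosure_eq_top_iff.2 ((Submodule.eq_bot_iff _).2 fun ξ hξ => ?_)
  refine L2n.ext fun e a => ?_
  rw [← inner_basisVec]
  exact (Submodule.mem_orthogonal _ _).1 hξ _ (Submodule.subset_span ⟨e, a, rfl⟩)

theorem L2n.continuousLinearMap_ext {E : Type*} [NormedAddCommGroup E] [NormedSpace ℂ E]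
    {B B' : L2n n α →L[ℂ] E} (h : ∀ e a, B (basisVec e a) = B' (basisVec e a)) : B = B' :=
  ContinuousLinearMap.ext_on
    (Submodule.dense_iff_topologicalClosure_eq_top.2 topologicalClosure_span_basisVec)
    (by rintro _ ⟨e, a, rfl⟩; exact h e a)

theorem l2nMap_basisVec (i : α ↪ β) (e : n) (a : α) :
    l2nMap n i (basisVec e a) = basisVec e (i a) := by
  classical
  refine L2n.ext fun e' b => ?_
  change Function.extend i (basisVec e a e' : α → ℂ) 0 b = _
  by_cases hb : ∃ a', i a' = b
  · obtain ⟨a', rfl⟩ := hb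
    simp [i.injective.extend_apply, basisVec_apply]
  · have hne : b ≠ i a := fun h => hb ⟨a, h.symm⟩
    rw [Function.extend_apply' _ _ _ hb, basisVec_apply, if_neg fun h => hne h.2]
    rfl

variable [Group G]

open Classical in
theorem rightMul_single_apply (x : MonoidAlgebra ℂ G) (γ h : G) :
    rightMul x (lp.single 2 γ 1) h = x.coeff (γ⁻¹ * h) := by
  have hterm (g : G) : l2Map (mulRightEmbedding g) (lp.single 2 γ 1) h =
      if g = γ⁻¹ * h then (1 : ℂ) else 0 := by
    have hext := (mulRightEmbedding g).injective.extend_apply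
      (lp.single 2 γ (1 : ℂ) : G → ℂ) 0 (h * g⁻¹)
    rw [mulRightEmbedding_apply, inv_mul_cancel_right] at hext
    refine hext.trans ?_
    rw [lp.single_apply, Pi.single_apply]
    exact if_congr ⟨fun h' => by rw [← h']; group, fun h' => by rw [h']; group⟩ rfl rfl
  have hsum : rightMul x (lp.single 2 γ 1) h =
      x.coeff.sum fun g c => c * l2Map (mulRightEmbedding g) (lp.single 2 γ 1) h := by
    rw [rightMul, Finsupp.sum, sum_apply, lp.coeFn_sum, Finset.sum_apply]
    rfl
  simp +contextual [hsum, hterm]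

theorem rightMulMatrix_basisVec (M : Matrix n n (MonoidAlgebra ℂ G)) (e e' : n) (γ h : G) :
    rightMulMatrix M (basisVec e γ) e' h = (M e e').coeff (γ⁻¹ * h) := by
  classical
  have hrow : rightMulMatrix M (basisVec e γ) e' = rightMul (M e e') (lp.single 2 γ 1) := by
    change (∑ i, rightMul (M i e') ∘L PiLp.proj 2 (fun _ : n => L2 G) i) (basisVec e γ) = _
    rw [sum_apply, Finset.sum_eq_single e]
    · simp [basisVec]
    · intro i _ hi
      simp [basisVec, hi]
    · simp
  rw [hrow, rightMul_single_apply]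

end L2

theorem extend_ratCast_apply {α β : Type*} [DecidableEq β] (i : α ↪ β) (p : α →₀ ℚ) (b : β) :
    Function.extend i (fun a => (p a : ℂ)) 0 b =
      p.sum fun a q => if i a = b then (q : ℂ) else 0 := by
  by_cases hb : ∃ a, i a = b
  · obtain ⟨a, rfl⟩ := hb
    have hsum : (p.sum fun a' q => if i a' = i a then (q : ℂ) else 0) = (p a : ℂ) := by
      rw [Finsupp.sum, Finset.sum_eq_single a (fun a' _ h => if_neg (i.injective.ne h))]
      · exact if_pos rfl
      · intro h
        rw [if_pos rfl, Finsupp.notMem_support_iff.1 h, Rat.cast_zero]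
    rw [i.injective.extend_apply, hsum]
  · rw [Function.extend_apply' _ _ _ hb, Finsupp.sum,
      Finset.sum_eq_zero fun a _ => if_neg fun h => hb ⟨a, h⟩]
    rfl

section RelativeChains

variable {V : Type u} [Quiver.{v} V] {x₀ : V} {H : Subgraph V}

theorem projRel_coe (x : relChain x₀ H) : projRel x₀ H (x : Chain₁ x₀) = x := by
  classical
  refine Subtype.ext (Finsupp.filter_eq_self_iff _ _ |>.2 fun e he => ?_)
  exact fun h => he (x.2 e h)

end RelativeChains

namespace BasedHomotopyEquiv

open scoped InnerProductSpace

variable {V : Type u} [Quiver.{v} V] {f : BasedHomotopyEquiv V} {H : Subgraph V}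

theorem incl_mul_t (g : Pi1 f.base) : f.incl g * f.t = f.t * f.incl (f.Phi g) := by
  rw [← f.t_inv_mul_incl_mul_t]
  group

theorem incl_injective : Function.Injective f.incl := SemidirectProduct.inl_injective

/-- The embedding `g ↦ γ g` of `𝔽` into `G_φ`. -/
def translateEmbedding (γ : f.FreeByCyclic) : Pi1 f.base ↪ f.FreeByCyclic where
  toFun g := γ * f.incl g
  inj' _ _ h := incl_injective (mul_left_cancel h)

theorem EdgeLifts.exists_act_eq (b : f.EdgeLifts H) {E : CoverEdge f.base} (hE : E.1 ∉ H.edges) :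
    ∃ (e : H.CoEdge) (g : Pi1 f.base), (b.edge e).act g = E := by
  refine ⟨⟨E.1, hE⟩, E.2 ≫ Groupoid.inv (b ⟨E.1, hE⟩), Sigma.ext rfl (heq_of_eq ?_)⟩
  change (E.2 ≫ Groupoid.inv (b ⟨E.1, hE⟩)) ≫ b ⟨E.1, hE⟩ = E.2
  rw [Category.assoc, Groupoid.inv_comp, Category.comp_id]

theorem EdgeLifts.act_eq_act_iff (b : f.EdgeLifts H) {e e' : H.CoEdge} {g g' : Pi1 f.base} :
    (b.edge e).act g = (b.edge e').act g' ↔ e = e' ∧ g = g' := by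
  refine ⟨fun h => ?_, by rintro ⟨rfl, rfl⟩; rfl⟩
  obtain rfl : e = e' := Subtype.ext (congrArg Sigma.fst h)
  exact ⟨rfl, (b.edge e).act_left_injective h⟩

variable [Finite (Quiver.Total V)] (b : f.EdgeLifts H)

theorem EdgeLifts.toL2_apply (x : Chain₁ f.base) (e : H.CoEdge) (g : Pi1 f.base) :
    b.toL2 x e g = (x ((b.edge e).act g) : ℂ) := rfl

theorem EdgeLifts.toL2_add (x y : Chain₁ f.base) : b.toL2 (x + y) = b.toL2 x + b.toL2 y :=
  L2n.ext fun _ _ => Rat.cast_add _ _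

theorem EdgeLifts.toL2_single_act (e : H.CoEdge) (g : Pi1 f.base) (c : ℚ) :
    b.toL2 (Finsupp.single ((b.edge e).act g) c) = (c : ℂ) • basisVec e g := by
  classical
  refine L2n.ext fun e' g' => ?_
  rw [b.toL2_apply, Finsupp.single_apply, PiLp.smul_apply, lp.coeFn_smul, Pi.smul_apply,
    basisVec_apply]
  simp only [b.act_eq_act_iff, eq_comm (a := e), eq_comm (a := g)]
  split_ifs <;> simp

theorem EdgeLifts.toL2_single_eq_zero {E : CoverEdge f.base} (hE : E.1 ∈ H.edges) (c : ℚ) :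
    b.toL2 (Finsupp.single E c) = 0 := by
  refine L2n.ext fun e g => ?_
  have hne : (b.edge e).act g ≠ E := fun h => e.2 (show ((b.edge e).act g).1 ∈ H.edges from h ▸ hE)
  rw [b.toL2_apply, Finsupp.single_eq_of_ne hne, Rat.cast_zero]
  rfl

/-- The translate `γ x` by `γ ∈ G_φ` of a rational 1-chain `x`, as a vector of `L²(G_φ)^{n_H}`. -/
def EdgeLifts.translate (γ : f.FreeByCyclic) : Chain₁ f.base →+ L2n H.CoEdge f.FreeByCyclic :=
  AddMonoidHom.mk' (fun x => l2nMap H.CoEdge (translateEmbedding γ) (b.toL2 x)) fun x y => by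
    rw [b.toL2_add, map_add]

theorem EdgeLifts.translate_apply (γ : f.FreeByCyclic) (x : Chain₁ f.base) (e : H.CoEdge)
    (g : Pi1 f.base) : b.translate γ x e (γ * f.incl g) = (x ((b.edge e).act g) : ℂ) :=
  (translateEmbedding γ).injective.extend_apply _ _ g

theorem EdgeLifts.translate_smul (γ : f.FreeByCyclic) (c : ℚ) (x : Chain₁ f.base) :
    b.translate γ (c • x) = (c : ℂ) • b.translate γ x := by
  simpa using map_ratCast_smul (b.translate γ) ℚ ℂ c x

theorem EdgeLifts.translate_single_act (γ : f.FreeByCyclic) (e : H.CoEdge) (g : Pi1 f.base)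
    (c : ℚ) : b.translate γ (Finsupp.single ((b.edge e).act g) c) =
      (c : ℂ) • basisVec e (γ * f.incl g) := by
  change l2nMap H.CoEdge (translateEmbedding γ) (b.toL2 _) = _
  rw [b.toL2_single_act, map_smul, l2nMap_basisVec]
  rfl

theorem EdgeLifts.translate_single_eq_zero (γ : f.FreeByCyclic) {E : CoverEdge f.base}
    (hE : E.1 ∈ H.edges) (c : ℚ) : b.translate γ (Finsupp.single E c) = 0 := by
  change l2nMap H.CoEdge (translateEmbedding γ) (b.toL2 _) = _
  rw [b.toL2_single_eq_zero hE, map_zero]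

theorem EdgeLifts.translate_edge (γ : f.FreeByCyclic) (e : H.CoEdge) :
    b.translate γ (Finsupp.single (b.edge e) 1) = basisVec e γ := by
  have hone : (b.edge e).act (1 : Pi1 f.base) = b.edge e :=
    Sigma.ext rfl (heq_of_eq (Category.id_comp _))
  rw [← hone, b.translate_single_act, Rat.cast_one, one_smul, map_one, mul_one]

theorem EdgeLifts.translate_chainAct (γ : f.FreeByCyclic) (g : Pi1 f.base) (x : Chain₁ f.base) :
    b.translate γ (chainAct g x) = b.translate (γ * f.incl g) x := by
  suffices h : (b.translate γ).comp (chainAct g).toAddMonoidHom = b.translate (γ * f.incl g) from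
    DFunLike.congr_fun h x
  refine Finsupp.addHom_ext fun E c => ?_
  change b.translate γ (chainAct g (Finsupp.single E c)) = _
  rw [chainAct_single]
  by_cases hE : E.1 ∈ H.edges
  · rw [b.translate_single_eq_zero _ hE, b.translate_single_eq_zero (E := E.act g) _ hE]
  · obtain ⟨e, h, rfl⟩ := b.exists_act_eq hE
    have hact : ((b.edge e).act h).act g = (b.edge e).act (g * h) :=
      Sigma.ext rfl (heq_of_eq (Category.assoc g h _).symm)
    rw [hact, b.translate_single_act, b.translate_single_act, map_mul, mul_assoc]

theorem EdgeLifts.translate_projRel (γ : f.FreeByCyclic) (x : Chain₁ f.base) :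
    b.translate γ (projRel f.base H x : Chain₁ f.base) = b.translate γ x := by
  induction x using Finsupp.induction_linear with
  | zero => rw [map_zero, ZeroMemClass.coe_zero]
  | add x y hx hy => rw [map_add, AddMemClass.coe_add, map_add, map_add, hx, hy]
  | single E c =>
    by_cases hE : E.1 ∈ H.edges
    · rw [projRel_single_eq_zero hE, ZeroMemClass.coe_zero, map_zero,
        b.translate_single_eq_zero _ hE]
    · rw [coe_projRel_single hE]

theorem EdgeLifts.inner_translate (γ : f.FreeByCyclic) (x : relChain f.base H)
    (y : Chain₁ f.base) :
    ⟪b.translate γ (x : Chain₁ f.base), b.translate γ y⟫_ℂ =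
      (chainInner (x : Chain₁ f.base) y : ℂ) := by
  have hsum : b.translate γ (x : Chain₁ f.base) = ∑ E ∈ (x : Chain₁ f.base).support,
      b.translate γ (Finsupp.single E ((x : Chain₁ f.base) E)) := by
    rw [← map_sum]
    exact congrArg _ (Finsupp.sum_single (x : Chain₁ f.base)).symm
  rw [hsum, sum_inner, chainInner, Finsupp.sum, Complex.ofReal_sum]
  refine Finset.sum_congr rfl fun E hE => ?_
  obtain ⟨e, g, rfl⟩ := b.exists_act_eq fun h => Finsupp.mem_support_iff.1 hE (x.2 E h)
  rw [b.translate_single_act, inner_smul_left, inner_basisVec, b.translate_apply]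
  simp

theorem EdgeLifts.norm_translate (γ : f.FreeByCyclic) (x : relChain f.base H) :
    ‖b.translate γ (x : Chain₁ f.base)‖ = chainNorm (x : Chain₁ f.base) := by
  rw [@norm_eq_sqrt_re_inner ℂ, b.inner_translate]
  rfl

/-- The matrix over the group ring of `G_φ` whose row at `e` is `s` times the row of coordinates of
the 1-chain `y e`. -/
def EdgeLifts.chainMatrix (s : f.FreeByCyclic) (y : H.CoEdge → Chain₁ f.base) :
    Matrix H.CoEdge H.CoEdge (MonoidAlgebra ℂ f.FreeByCyclic) :=
  fun e e' => (b.coord (y e) e').sum fun g q => MonoidAlgebra.single (s * f.incl g) (q : ℂ)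

theorem EdgeLifts.rightMulMatrix_chainMatrix (s : f.FreeByCyclic) (y : H.CoEdge → Chain₁ f.base)
    (e : H.CoEdge) (γ : f.FreeByCyclic) :
    rightMulMatrix (b.chainMatrix s y) (basisVec e γ) = b.translate (γ * s) (y e) := by
  classical
  refine L2n.ext fun e' h => ?_
  have hcoeff : (b.chainMatrix s y e e').coeff (γ⁻¹ * h) = (b.coord (y e) e').sum fun g q =>
      if s * f.incl g = γ⁻¹ * h then (q : ℂ) else 0 := by
    rw [chainMatrix, Finsupp.sum, MonoidAlgebra.coeff_sum, Finsupp.finsetSum_apply]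
    simp only [MonoidAlgebra.coeff_single, Finsupp.single_apply]
    rfl
  rw [rightMulMatrix_basisVec, hcoeff]
  refine Eq.trans ?_ (extend_ratCast_apply (translateEmbedding (γ * s)) _ h).symm
  refine Finsupp.sum_congr fun g _ => if_congr ?_ rfl rfl
  rw [eq_inv_mul_iff_mul_eq, ← mul_assoc]
  exact Iff.rfl

theorem EdgeLifts.L_translate_projRel (γ : f.FreeByCyclic) (x : Chain₁ f.base) :
    f.L b (b.translate γ (projRel f.base H x : Chain₁ f.base)) =
      b.translate (γ * f.t) (f.ARel H (projRel f.base H x) : Chain₁ f.base) := by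
  induction x using Finsupp.induction_linear with
  | zero => simp only [map_zero, ZeroMemClass.coe_zero]
  | add x y hx hy => simp only [map_add, AddMemClass.coe_add, hx, hy]
  | single E c =>
    by_cases hE : E.1 ∈ H.edges
    · simp only [projRel_single_eq_zero hE, ZeroMemClass.coe_zero, map_zero]
    · change _ = b.translate _ (projRel f.base H (f.A (projRel f.base H _)) : Chain₁ f.base)
      rw [b.translate_projRel, coe_projRel_single hE]
      obtain ⟨e, g, rfl⟩ := b.exists_act_eq hE
      have hsingle : Finsupp.single ((b.edge e).act g) c =
          c • chainAct g (Finsupp.single (b.edge e) 1) := by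
        rw [chainAct_single, Finsupp.smul_single, smul_eq_mul, mul_one]
      rw [hsingle, b.translate_smul, map_smul, map_smul, map_smul, Submodule.coe_smul,
        b.translate_smul, b.translate_projRel, A_chainAct,
        b.translate_chainAct, b.translate_chainAct, b.translate_edge, mul_assoc γ f.t,
        ← incl_mul_t, ← mul_assoc]
      exact congrArg _ (b.rightMulMatrix_chainMatrix f.t _ e _)

theorem EdgeLifts.L_translate (γ : f.FreeByCyclic) (x : relChain f.base H) :
    f.L b (b.translate γ (x : Chain₁ f.base)) =
      b.translate (γ * f.t) (f.ARel H x : Chain₁ f.base) := by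
  simpa only [projRel_coe] using b.L_translate_projRel γ (x : Chain₁ f.base)

theorem EdgeLifts.L_pow_translate (j : ℕ) (γ : f.FreeByCyclic) (x : relChain f.base H) :
    (f.L b ^ j) (b.translate γ (x : Chain₁ f.base)) =
      b.translate (γ * f.t ^ j) ((f.ARel H ^ j) x : Chain₁ f.base) := by
  induction j with
  | zero => simp
  | succ j ih =>
    rw [pow_succ', mul_apply_eq_comp, ih, b.L_translate, mul_assoc, ← pow_succ,
      pow_succ' (f.ARel H), Module.End.mul_apply]

end BasedHomotopyEquiv

section HaagerupSchultz

theorem exists_tendsto_diagonal {P : ℕ → ℕ → Prop} (h : ∀ n, ∀ᶠ j in atTop, P n j) :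
    ∃ N : ℕ → ℕ, Tendsto N atTop atTop ∧ ∀ᶠ j in atTop, P (N j) j := by
  classical
  refine ⟨fun j => Nat.findGreatest (fun n => P n j) j, ?_, ?_⟩
  · refine tendsto_atTop.2 fun n => ?_
    filter_upwards [h n, eventually_ge_atTop n] with j hj hnj
    exact Nat.le_findGreatest hnj hj
  · filter_upwards [h 0] with j hj
    exact Nat.findGreatest_spec (P := fun n => P n j) (Nat.zero_le j) hj

theorem eventually_mul_pow_lt_pow (C : ℝ) {μ' μ : ℝ} (h₀ : 0 < μ') (h : μ' < μ) :
    ∀ᶠ j : ℕ in atTop, C * μ' ^ j < μ ^ j := by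
  have hratio : 1 < μ / μ' := (one_lt_div h₀).2 h
  filter_upwards [(tendsto_pow_atTop_atTop_of_one_lt hratio).eventually_gt_atTop C] with j hj
  rwa [div_pow, lt_div_iff₀ (pow_pos h₀ j)] at hj

theorem enorm_rpow_inv_lt_ofReal_iff {E : Type*} [SeminormedAddGroup E] {w : E} {μ : ℝ} {j : ℕ}
    (hμ : 0 < μ) (hj : 0 < j) : ‖w‖ₑ ^ (1 / (j : ℝ)) < ENNReal.ofReal μ ↔ ‖w‖ < μ ^ j := by
  rw [one_div, ENNReal.rpow_inv_lt_iff (Nat.cast_pos.2 hj), ENNReal.rpow_natCast,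
    ← ENNReal.ofReal_pow hμ.le, ← ofReal_norm, ENNReal.ofReal_lt_ofReal_iff (pow_pos hμ j)]

theorem limsup_enorm_rpow_inv_le_iff {E : Type*} [SeminormedAddGroup E] {w : ℕ → E} {ν : ℝ}
    (hν : 0 ≤ ν) :
    limsup (fun j : ℕ => ‖w j‖ₑ ^ (1 / (j : ℝ))) atTop ≤ ENNReal.ofReal ν ↔
      ∀ μ, ν < μ → ∀ᶠ j in atTop, ‖w j‖ < μ ^ j := by
  constructor
  · intro h μ hμ
    have hμ₀ := hν.trans_lt hμ
    filter_upwards [eventually_lt_of_limsup_lt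
      (h.trans_lt ((ENNReal.ofReal_lt_ofReal_iff hμ₀).2 hμ)), eventually_gt_atTop 0] with j hj hj₀
    exact (enorm_rpow_inv_lt_ofReal_iff hμ₀ hj₀).1 hj
  · intro h
    refine le_of_forall_gt fun c hc => ?_
    obtain ⟨μ, -, hνμ, hμc⟩ := ENNReal.lt_iff_exists_real_btwn.1 hc
    have hμ : ν < μ := (ENNReal.ofReal_lt_ofReal_iff_of_nonneg hν).1 hνμ
    refine lt_of_le_of_lt (limsup_le_of_le (h := ?_)) hμc
    filter_upwards [h μ hμ, eventually_gt_atTop 0] with j hj hj₀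
    exact ((enorm_rpow_inv_lt_ofReal_iff (hν.trans_lt hμ) hj₀).2 hj).le

variable {𝕜 E F G : Type*} [NormedField 𝕜] [AddCommGroup E] [Module 𝕜 E]
  [SeminormedAddCommGroup G] [NormedSpace 𝕜 G]

section Topological

variable [AddCommGroup F] [Module 𝕜 F] [TopologicalSpace F] [ContinuousAdd F]
  [ContinuousConstSMul 𝕜 F]

/-- The common form of the subspaces of Haagerup and Schultz: the limits of sequences `U j (s j)`
for which `W j (s j)` has exponential growth rate at most `ν`. It is described by neighbourhoods
instead of sequences; `mem_growthSubmodule_iff_exists_seq` is the translation. -/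
def growthSubmodule (U : ℕ → E →ₗ[𝕜] F) (W : ℕ → E →ₗ[𝕜] G) {ν : ℝ} (hν : 0 ≤ ν) :
    Submodule 𝕜 F where
  carrier := {ξ | ∀ μ, ν < μ → ∀ O ∈ 𝓝 ξ, ∀ᶠ j in atTop, ∃ η, U j η ∈ O ∧ ‖W j η‖ < μ ^ j}
  zero_mem' μ hμ O hO := Eventually.of_forall fun j => ⟨0, by
    rw [map_zero, map_zero, norm_zero]
    exact ⟨mem_of_mem_nhds hO, pow_pos (hν.trans_lt hμ) j⟩⟩
  add_mem' {ξ ξ'} hξ hξ' μ hμ O hO := by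
    obtain ⟨μ', hνμ', hμ'⟩ := exists_between hμ
    obtain ⟨O₁, hO₁, O₂, hO₂, hsub⟩ := mem_nhds_prod_iff.1 (continuous_add.tendsto (ξ, ξ') hO)
    filter_upwards [hξ μ' hνμ' O₁ hO₁, hξ' μ' hνμ' O₂ hO₂,
      eventually_mul_pow_lt_pow 2 (hν.trans_lt hνμ') hμ'] with j ⟨η, hη, hlt⟩ ⟨η', hη', hlt'⟩ h
    refine ⟨η + η', ?_, ?_⟩
    · rw [map_add]
      exact hsub (Set.mk_mem_prod hη hη')
    · rw [map_add]
      exact (norm_add_le _ _).trans_lt (by linarith)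
  smul_mem' c ξ hξ μ hμ O hO := by
    obtain ⟨μ', hνμ', hμ'⟩ := exists_between hμ
    filter_upwards [hξ μ' hνμ' _ ((continuous_const_smul c).tendsto ξ hO),
      eventually_mul_pow_lt_pow ‖c‖ (hν.trans_lt hνμ') hμ'] with j ⟨η, hη, hlt⟩ h
    refine ⟨c • η, ?_, ?_⟩
    · rw [map_smul]
      exact hη
    · rw [map_smul, norm_smul]
      exact (mul_le_mul_of_nonneg_left hlt.le (norm_nonneg c)).trans_lt h

variable {U : ℕ → E →ₗ[𝕜] F} {W : ℕ → E →ₗ[𝕜] G} {ν : ℝ}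

theorem isClosed_growthSubmodule (hν : 0 ≤ ν) :
    IsClosed (growthSubmodule U W hν : Set F) := by
  refine isClosed_of_closure_subset fun ξ hξ μ hμ O hO => ?_
  obtain ⟨ξ', hξ'O, hξ'⟩ := mem_closure_iff_nhds.1 hξ _ (interior_mem_nhds.2 hO)
  exact hξ' μ hμ O (mem_interior_iff_mem_nhds.1 hξ'O)

theorem mem_growthSubmodule_of_bounded (hν : 1 ≤ ν) {ξ : F} (C : ℝ)
    (h : ∀ j, ∃ η, U j η = ξ ∧ ‖W j η‖ ≤ C) :
    ξ ∈ growthSubmodule U W (zero_le_one.trans hν) := by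
  intro μ hμ O hO
  filter_upwards [eventually_mul_pow_lt_pow C one_pos (hν.trans_lt hμ)] with j hj
  obtain ⟨η, rfl, hη⟩ := h j
  rw [one_pow, mul_one] at hj
  exact ⟨η, mem_of_mem_nhds hO, hη.trans_lt hj⟩

end Topological

variable [SeminormedAddCommGroup F] [NormedSpace 𝕜 F]
  {U : ℕ → E →ₗ[𝕜] F} {W : ℕ → E →ₗ[𝕜] G} {ν : ℝ}

theorem mem_growthSubmodule_iff_exists_seq (hν : 0 ≤ ν) {ξ : F} :
    ξ ∈ growthSubmodule U W hν ↔
      ∃ s : ℕ → E, Tendsto (fun j => ‖U j (s j) - ξ‖) atTop (𝓝 0) ∧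
        limsup (fun j : ℕ => ‖W j (s j)‖ₑ ^ (1 / (j : ℝ))) atTop ≤ ENNReal.ofReal ν := by
  constructor
  · intro h
    have hpos (n : ℕ) : (0 : ℝ) < 1 / (n + 1) := Nat.one_div_pos_of_nat
    obtain ⟨N, hN, hP⟩ := exists_tendsto_diagonal fun n =>
      h _ (lt_add_of_pos_right ν (hpos n)) _ (Metric.ball_mem_nhds ξ (hpos n))
    choose! s hs using fun (j : ℕ) (hj : ∃ η, U j η ∈ Metric.ball ξ (1 / (N j + 1 : ℝ)) ∧
      ‖W j η‖ < (ν + 1 / (N j + 1 : ℝ)) ^ j) => hj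
    have hlim : Tendsto (fun j => (1 : ℝ) / (N j + 1)) atTop (𝓝 0) :=
      tendsto_one_div_add_atTop_nhds_zero_nat.comp hN
    refine ⟨s, squeeze_zero' (Eventually.of_forall fun _ => norm_nonneg _) ?_ hlim,
      (limsup_enorm_rpow_inv_le_iff hν).2 fun μ hμ => ?_⟩
    · filter_upwards [hP] with j hj using (mem_ball_iff_norm.1 (hs j hj).1).le
    · filter_upwards [hP, hlim.eventually_lt_const (sub_pos.2 hμ)] with j hj hj'
      exact (hs j hj).2.trans_le
        (pow_le_pow_left₀ (add_nonneg hν (hpos _).le) (lt_sub_iff_add_lt'.1 hj').le j)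
  · rintro ⟨s, hs, hlim⟩ μ hμ O hO
    filter_upwards [tendsto_iff_norm_sub_tendsto_zero.2 hs hO,
      (limsup_enorm_rpow_inv_le_iff hν).1 hlim μ hμ] with j hO hlt using ⟨s j, hO, hlt⟩

end HaagerupSchultz

section HaagerupSchultzSubspaces

variable {E : Type*} [NormedAddCommGroup E] [NormedSpace ℂ E] {ν : ℝ}

theorem hsE_eq_growthSubmodule (B : E →L[ℂ] E) (hν : 0 ≤ ν) :
    hsE B ν = growthSubmodule (fun _ => LinearMap.id) (fun j => (B ^ j).toLinearMap) hν := by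
  ext ξ
  rw [SetLike.mem_coe, mem_growthSubmodule_iff_exists_seq]
  rfl

theorem hsF_inv_eq_growthSubmodule (B : E →L[ℂ] E) (hν : 0 ≤ ν) :
    hsF B ν⁻¹ = growthSubmodule (fun j => (B ^ j).toLinearMap) (fun _ => LinearMap.id) hν := by
  ext ξ
  rw [SetLike.mem_coe, mem_growthSubmodule_iff_exists_seq, hsF, inv_inv]
  rfl

/-- The subspace `𝔈(B, ν) ∩ 𝔉(B, ν⁻¹)`. -/
def hsSubmodule (B : E →L[ℂ] E) {ν : ℝ} (hν : 0 ≤ ν) : Submodule ℂ E :=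
  growthSubmodule (fun _ => LinearMap.id) (fun j => (B ^ j).toLinearMap) hν ⊓
    growthSubmodule (fun j => (B ^ j).toLinearMap) (fun _ => LinearMap.id) hν

theorem coe_hsSubmodule (B : E →L[ℂ] E) (hν : 0 ≤ ν) :
    (hsSubmodule B hν : Set E) = hsE B ν ∩ hsF B ν⁻¹ := by
  rw [hsE_eq_growthSubmodule B hν, hsF_inv_eq_growthSubmodule B hν]
  rfl

theorem isClosed_hsSubmodule (B : E →L[ℂ] E) (hν : 0 ≤ ν) :
    IsClosed (hsSubmodule B hν : Set E) :=
  (isClosed_growthSubmodule hν).inter (isClosed_growthSubmodule hν)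

end HaagerupSchultzSubspaces

section Flaring

/-- The sequence `a` satisfies the flare inequality with constant `lam`: no term exceeds the larger
of its two neighbours divided by `lam`. -/
def Flares (lam : ℝ) (a : ℕ → ℝ) : Prop :=
  ∀ k, lam * a (k + 1) ≤ max (a (k + 2)) (a k)

variable {lam : ℝ} {a : ℕ → ℝ}

theorem Flares.growth (hlam : 1 < lam) (ha : ∀ k, 0 ≤ a k) (h : Flares lam a)
    (hle : a 0 ≤ a 1) (k : ℕ) : lam ^ k * a 1 ≤ a (k + 1) := by
  suffices hk : a k ≤ a (k + 1) ∧ lam ^ k * a 1 ≤ a (k + 1) from hk.2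
  induction k with
  | zero => exact ⟨hle, by rw [pow_zero, one_mul]⟩
  | succ k ih =>
    have hstep : lam * a (k + 1) ≤ a (k + 2) := by
      rcases le_max_iff.1 (h k) with h' | h'
      · exact h'
      · nlinarith [ha (k + 1), ha (k + 2)]
    refine ⟨by nlinarith [ha (k + 1)], ?_⟩
    rw [pow_succ', mul_assoc]
    exact (mul_le_mul_of_nonneg_left ih.2 (by linarith)).trans hstep

theorem Flares.decay (hlam : 1 < lam) (ha : ∀ k, 0 ≤ a k) (h : Flares lam a) {j : ℕ}
    (hlt : a (j + 1) < lam * a j) : lam ^ j * a j ≤ a 0 := by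
  induction j with
  | zero => rw [pow_zero, one_mul]
  | succ j ih =>
    have hstep : lam * a (j + 1) ≤ a j :=
      (le_max_iff.1 (h j)).resolve_left (not_le.2 hlt)
    have hpos : 0 < a (j + 1) :=
      (pos_iff_pos_of_mul_pos ((ha (j + 2)).trans_lt hlt)).1 (zero_lt_one.trans hlam)
    have hlt' : a (j + 1) < lam * a j := calc
      a (j + 1) < lam * a (j + 1) := lt_mul_of_one_lt_left hpos hlam
      _ ≤ a j := hstep
      _ ≤ lam * a j := le_mul_of_one_le_left (ha j) hlam.le
    rw [pow_succ, mul_assoc]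
    exact (mul_le_mul_of_nonneg_left hstep (by positivity)).trans (ih hlt')

end Flaring

section FlaringOrbits

variable {E : Type*} {B : E → E} {lam μ : ℝ} {ω : E}

theorem norm_map_le_norm_of_frequently_flares [SeminormedAddGroup E] (hB : Continuous B)
    (hlam : 1 < lam) (hμ : 0 < μ) (hμlam : μ < lam)
    (h : ∀ O ∈ 𝓝 ω, ∃ᶠ j in atTop, ∃ z ∈ O,
      Flares lam (fun k => ‖B^[k] z‖) ∧ ‖B^[j] z‖ < μ ^ j) :
    ‖B ω‖ ≤ ‖ω‖ := by
  by_contra! hlt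
  have hpos : 0 < ‖B ω‖ / 2 := half_pos ((norm_nonneg ω).trans_lt hlt)
  have hO : ∀ᶠ z in 𝓝 ω, ‖z‖ < ‖B z‖ ∧ ‖B ω‖ / 2 < ‖B z‖ :=
    (continuous_norm.tendsto ω |>.eventually_lt (hB.norm.tendsto ω) hlt).and
      ((hB.norm.tendsto ω).eventually_const_lt (by linarith))
  obtain ⟨j, ⟨z, ⟨hz, hBz⟩, hflare, hzj⟩, hj₀, hj⟩ :=
    ((h _ hO).and_eventually ((eventually_gt_atTop 0).and
      (eventually_mul_pow_lt_pow (lam / (‖B ω‖ / 2)) hμ hμlam))).exists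
  obtain ⟨k, rfl⟩ := Nat.exists_eq_add_one.2 hj₀
  have hgrowth : lam ^ k * ‖B z‖ ≤ ‖B^[k + 1] z‖ :=
    hflare.growth hlam (fun _ => norm_nonneg _) hz.le k
  rw [div_mul_eq_mul_div, div_lt_iff₀ hpos, pow_succ' lam, mul_assoc] at hj
  have hlow : μ ^ (k + 1) < lam ^ k * (‖B ω‖ / 2) :=
    lt_of_mul_lt_mul_left hj (zero_le_one.trans hlam.le)
  have : lam ^ k * (‖B ω‖ / 2) ≤ lam ^ k * ‖B z‖ :=
    mul_le_mul_of_nonneg_left hBz.le (by positivity)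
  linarith

theorem mul_norm_le_norm_map_of_frequently_flares [SeminormedAddGroup E] (hB : Continuous B)
    (hlam : 1 < lam) (hμ : 0 < μ) (hμlam : μ < lam)
    (h : ∀ O ∈ 𝓝 ω, ∃ᶠ j in atTop, ∃ y, B^[j] y ∈ O ∧
      Flares lam (fun k => ‖B^[k] y‖) ∧ ‖y‖ < μ ^ j) :
    lam * ‖ω‖ ≤ ‖B ω‖ := by
  by_contra! hlt
  have hpos : 0 < ‖ω‖ / 2 := half_pos <|
    (pos_iff_pos_of_mul_pos ((norm_nonneg _).trans_lt hlt)).1 (zero_lt_one.trans hlam)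
  have hO : ∀ᶠ z in 𝓝 ω, ‖B z‖ < lam * ‖z‖ ∧ ‖ω‖ / 2 < ‖z‖ :=
    ((hB.norm.tendsto ω).eventually_lt ((continuous_norm.tendsto ω).const_mul lam) hlt).and
      ((continuous_norm.tendsto ω).eventually_const_lt (by linarith))
  obtain ⟨j, ⟨y, ⟨hBz, hz⟩, hflare, hyj⟩, hj⟩ :=
    ((h _ hO).and_eventually (eventually_mul_pow_lt_pow (‖ω‖ / 2)⁻¹ hμ hμlam)).exists
  have hdecay : lam ^ j * ‖B^[j] y‖ ≤ ‖y‖ := by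
    refine hflare.decay hlam (fun _ => norm_nonneg _) ?_
    rwa [← Function.iterate_succ_apply' B j y] at hBz
  rw [inv_mul_lt_iff₀' hpos] at hj
  have : lam ^ j * (‖ω‖ / 2) ≤ lam ^ j * ‖B^[j] y‖ :=
    mul_le_mul_of_nonneg_left hz.le (by positivity)
  linarith

theorem eq_zero_of_frequently_flares [NormedAddGroup E] (hB : Continuous B)
    (hlam : 1 < lam) (hμ : 0 < μ) (hμlam : μ < lam)
    (hforward : ∀ O ∈ 𝓝 ω, ∃ᶠ j in atTop, ∃ z ∈ O,
      Flares lam (fun k => ‖B^[k] z‖) ∧ ‖B^[j] z‖ < μ ^ j)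
    (hbackward : ∀ O ∈ 𝓝 ω, ∃ᶠ j in atTop, ∃ y, B^[j] y ∈ O ∧
      Flares lam (fun k => ‖B^[k] y‖) ∧ ‖y‖ < μ ^ j) : ω = 0 := by
  have hle := norm_map_le_norm_of_frequently_flares hB hlam hμ hμlam hforward
  have hge := mul_norm_le_norm_map_of_frequently_flares hB hlam hμ hμlam hbackward
  rw [← norm_le_zero_iff]
  nlinarith [norm_nonneg ω]

end FlaringOrbits

section RealPart

open scoped lp

variable {n α : Type*} [Fintype n]

theorem L2n.basisVec_induction {p : L2n n α → Prop} (closed : IsClosed {ξ | p ξ}) (zero : p 0)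
    (add : ∀ ξ η, p ξ → p η → p (ξ + η)) (smul_basisVec : ∀ (c : ℂ) e a, p (c • basisVec e a))
    (ξ : L2n n α) : p ξ := by
  have hξ : ξ ∈ (Submodule.span ℂ {ξ : L2n n α | ∃ e a, ξ = basisVec e a}).topologicalClosure := by
    rw [topologicalClosure_span_basisVec]
    exact Submodule.mem_top
  refine mem_topologicalClosure_span_induction closed zero add ?_ hξ
  rintro c _ ⟨e, a, rfl⟩
  exact smul_basisVec c e a

open Classical in
/-- The vector whose coefficients at the elements of `S` are the real parts of those of `ξ`, and
whose other coefficients vanish. It is only additive, since it does not commute with complex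
scalars. -/
def realPart (S : Set α) : L2n n α →+ L2n n α where
  toFun ξ := WithLp.toLp 2 fun e => ⟨fun a => if a ∈ S then ((ξ e a).re : ℂ) else 0,
    (ξ e).2.mono' fun a => by
      split_ifs
      · rw [Complex.norm_real]
        exact Complex.abs_re_le_norm _
      · rw [norm_zero]
        exact norm_nonneg _⟩
  map_zero' := by
    refine L2n.ext fun e a => ?_
    change (if a ∈ S then (((0 : ℂ).re : ℝ) : ℂ) else 0) = 0
    rw [Complex.zero_re, Complex.ofReal_zero, ite_self]
  map_add' ξ η := by
    refine L2n.ext fun e a => ?_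
    change (if a ∈ S then (((ξ e a + η e a).re : ℝ) : ℂ) else 0) =
      (if a ∈ S then ((ξ e a).re : ℂ) else 0) + if a ∈ S then ((η e a).re : ℂ) else 0
    rw [Complex.add_re, Complex.ofReal_add, ite_add_zero]

theorem realPart_apply_of_mem {S : Set α} {a : α} (h : a ∈ S) (ξ : L2n n α) (e : n) :
    realPart S ξ e a = ((ξ e a).re : ℂ) := if_pos h

theorem realPart_apply_of_notMem {S : Set α} {a : α} (h : a ∉ S) (ξ : L2n n α) (e : n) :
    realPart S ξ e a = 0 := if_neg h

theorem norm_realPart_le (S : Set α) (ξ : L2n n α) : ‖realPart S ξ‖ ≤ ‖ξ‖ := by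
  rw [PiLp.norm_eq_of_L2, PiLp.norm_eq_of_L2]
  refine Real.sqrt_le_sqrt (Finset.sum_le_sum fun e _ => ?_)
  refine pow_le_pow_left₀ (norm_nonneg _) (lp.norm_mono two_ne_zero fun a => ?_) 2
  by_cases h : a ∈ S
  · rw [realPart_apply_of_mem h, Complex.norm_real]
    exact Complex.abs_re_le_norm _
  · rw [realPart_apply_of_notMem h, norm_zero]
    exact norm_nonneg _

theorem continuous_realPart (S : Set α) : Continuous (realPart S : L2n n α → L2n n α) :=
  AddMonoidHomClass.continuous_of_bound _ 1 fun ξ => by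
    rw [one_mul]
    exact norm_realPart_le S ξ

theorem realPart_smul_basisVec (S : Set α) (c : ℂ) (e : n) (a : α) :
    realPart S (c • basisVec e a) = S.indicator (fun _ => (c.re : ℂ)) a • basisVec e a := by
  classical
  refine L2n.ext fun e' a' => ?_
  have hsmul (d : ℂ) : (d • basisVec e a : L2n n α) e' a' = if e' = e ∧ a' = a then d else 0 := by
    change d * basisVec e a e' a' = _
    rw [basisVec_apply, mul_ite, mul_one, mul_zero]
  by_cases h : a' ∈ S
  · rw [realPart_apply_of_mem h, hsmul, hsmul]
    split_ifs with heq
    · rw [← heq.2, Set.indicator_of_mem h]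
    · rw [Complex.zero_re, Complex.ofReal_zero]
  · rw [realPart_apply_of_notMem h, hsmul]
    split_ifs with heq
    · rw [← heq.2, Set.indicator_of_notMem h]
    · rfl

theorem eq_zero_of_realPart_smul {ι : Sort*} {S : ι → Set α} (hS : ∀ a, ∃ i, a ∈ S i)
    {ξ : L2n n α} (h : ∀ (c : ℂ) i, realPart (S i) (c • ξ) = 0) : ξ = 0 := by
  refine L2n.ext fun e a => ?_
  obtain ⟨i, hi⟩ := hS a
  have hre (c : ℂ) : (c * ξ e a).re = 0 := by
    have hzero : realPart (S i) (c • ξ) e a = 0 := by rw [h]; rfl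
    rw [realPart_apply_of_mem hi] at hzero
    exact Complex.ofReal_eq_zero.1 hzero
  exact Complex.ext (by simpa using hre 1) (by simpa using hre Complex.I)

end RealPart

namespace BasedHomotopyEquiv

variable {V : Type u} [Quiver.{v} V] {f : BasedHomotopyEquiv V} {H : Subgraph V}

variable (f) in
/-- The coset `t^l 𝔽` of `G_φ`. -/
def coset (l : ℤ) : Set f.FreeByCyclic :=
  {γ | SemidirectProduct.rightHom γ = Multiplicative.ofAdd l}

theorem mul_incl_mem_coset_iff {l : ℤ} {γ : f.FreeByCyclic} (g : Pi1 f.base) :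
    γ * f.incl g ∈ f.coset l ↔ γ ∈ f.coset l := by
  simp [coset, incl]

theorem mul_t_mem_coset_iff {l : ℤ} {γ : f.FreeByCyclic} :
    γ * f.t ∈ f.coset (l + 1) ↔ γ ∈ f.coset l := by
  simp [coset, t, ofAdd_add]

theorem t_zpow_mem_coset_iff {k l : ℤ} : f.t ^ k ∈ f.coset l ↔ k = l := by
  rw [coset, Set.mem_ofPred_eq, map_zpow, t, SemidirectProduct.rightHom_inr, ← ofAdd_zsmul,
    smul_eq_mul, mul_one, EmbeddingLike.apply_eq_iff_eq]

theorem exists_mem_coset (γ : f.FreeByCyclic) : ∃ l, γ ∈ f.coset l :=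
  ⟨Multiplicative.toAdd (SemidirectProduct.rightHom γ), rfl⟩

theorem exists_eq_t_zpow_mul_incl (γ : f.FreeByCyclic) :
    ∃ (l : ℤ) (g : Pi1 f.base), γ = f.t ^ l * f.incl g := by
  obtain ⟨l, hl⟩ := exists_mem_coset γ
  have hker : (f.t ^ l)⁻¹ * γ ∈ (SemidirectProduct.rightHom :
      f.FreeByCyclic →* Multiplicative ℤ).ker := by
    rw [MonoidHom.mem_ker, map_mul, map_inv, hl, (t_zpow_mem_coset_iff.2 rfl : _ ∈ f.coset l),
      inv_mul_cancel]
  rw [← SemidirectProduct.range_inl_eq_ker_rightHom] at hker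
  obtain ⟨g, hg⟩ := hker
  exact ⟨l, g, eq_mul_of_inv_mul_eq hg.symm⟩

variable [Finite (Quiver.Total V)] (b : f.EdgeLifts H)

theorem realPart_coset_smul_translate (l : ℤ) (c : ℂ) (γ : f.FreeByCyclic) (x : Chain₁ f.base) :
    realPart (f.coset l) (c • b.translate γ x) =
      (f.coset l).indicator (fun _ => (c.re : ℂ)) γ • b.translate γ x := by
  induction x using Finsupp.induction_linear with
  | zero => simp only [map_zero, smul_zero]
  | add x y hx hy => rw [map_add, smul_add, map_add, hx, hy, smul_add]
  | single E q =>
    by_cases hE : E.1 ∈ H.edges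
    · simp only [b.translate_single_eq_zero _ hE, smul_zero, map_zero]
    · obtain ⟨e, g, rfl⟩ := b.exists_act_eq hE
      rw [b.translate_single_act, smul_smul, smul_smul, realPart_smul_basisVec]
      congr 1
      by_cases hγ : γ ∈ f.coset l
      · rw [Set.indicator_of_mem hγ, Set.indicator_of_mem ((mul_incl_mem_coset_iff g).2 hγ)]
        simp
      · rw [Set.indicator_of_notMem hγ, zero_mul,
          Set.indicator_of_notMem (mt (mul_incl_mem_coset_iff g).1 hγ)]

variable {b}

theorem realPart_coset_L (l : ℤ) (ξ : L2n H.CoEdge f.FreeByCyclic) :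
    realPart (f.coset (l + 1)) (f.L b ξ) = f.L b (realPart (f.coset l) ξ) := by
  refine L2n.basisVec_induction
    (p := fun ξ => realPart (f.coset (l + 1)) (f.L b ξ) = f.L b (realPart (f.coset l) ξ))
    (isClosed_eq ((continuous_realPart _).comp (f.L b).continuous)
      ((f.L b).continuous.comp (continuous_realPart _))) ?_ ?_ ?_ ξ
  · simp only [map_zero]
  · intro ξ η hξ hη
    simp only [map_add, hξ, hη]
  · intro c e γ
    have hindicator : (f.coset (l + 1)).indicator (fun _ => (c.re : ℂ)) (γ * f.t) =
        (f.coset l).indicator (fun _ => (c.re : ℂ)) γ :=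
      Set.indicator_eq_indicator mul_t_mem_coset_iff rfl
    rw [← b.translate_edge, ← b.translate_projRel, map_smul, b.L_translate,
      realPart_coset_smul_translate, realPart_coset_smul_translate, map_smul, b.L_translate,
      hindicator]

theorem realPart_coset_L_pow (l : ℤ) (j : ℕ) (ξ : L2n H.CoEdge f.FreeByCyclic) :
    realPart (f.coset (l + j)) ((f.L b ^ j) ξ) = (f.L b ^ j) (realPart (f.coset l) ξ) := by
  induction j with
  | zero => rw [Nat.cast_zero, add_zero, pow_zero, one_apply_eq_self, one_apply_eq_self]
  | succ j ih =>
    rw [pow_succ', mul_apply_eq_comp, mul_apply_eq_comp, ← ih, Nat.cast_succ, ← add_assoc,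
      realPart_coset_L]

variable (b)

theorem inducedL2_eq_topologicalClosure_span (W : Submodule ℚ (relChain f.base H)) :
    f.inducedL2 b W = (Submodule.span ℂ {ξ | ∃ (l : ℤ), ∃ x ∈ W,
      ξ = b.translate (f.t ^ l) (x : Chain₁ f.base)}).topologicalClosure := by
  refine le_antisymm ?_ (Submodule.topologicalClosure_mono (Submodule.span_le.2 ?_))
  · refine Submodule.topologicalClosure_minimal _ (iSup_le fun l => ?_)
      (Submodule.isClosed_topologicalClosure _)
    refine Submodule.map_le_iff_le_comap.2 (Submodule.topologicalClosure_minimal _ ?_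
      ((Submodule.isClosed_topologicalClosure _).preimage
        (l2nMap H.CoEdge (f.cosetEmbedding l)).continuous))
    refine Submodule.span_le.2 ?_
    rintro _ ⟨x, hx, rfl⟩
    exact Submodule.le_topologicalClosure _ (Submodule.subset_span ⟨l, x, hx, rfl⟩)
  · rintro _ ⟨l, x, hx, rfl⟩
    exact Submodule.mem_iSup_of_mem l ⟨_, Submodule.le_topologicalClosure _
      (Submodule.subset_span ⟨x, hx, rfl⟩), rfl⟩

variable {W W' : Submodule ℚ (relChain f.base H)}

theorem translate_mem_inducedL2 (hW : IsPi1Stable W) (γ : f.FreeByCyclic) {x : relChain f.base H}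
    (hx : x ∈ W) : b.translate γ (x : Chain₁ f.base) ∈ f.inducedL2 b W := by
  obtain ⟨l, g, rfl⟩ := exists_eq_t_zpow_mul_incl γ
  rw [← b.translate_chainAct, inducedL2_eq_topologicalClosure_span]
  exact Submodule.le_topologicalClosure _ (Submodule.subset_span ⟨l, _, hW g x hx, rfl⟩)

theorem inducedL2_top : f.inducedL2 b (⊤ : Submodule ℚ (relChain f.base H)) = ⊤ := by
  refine top_unique ?_
  rw [← topologicalClosure_span_basisVec]
  refine Submodule.topologicalClosure_minimal _ (Submodule.span_le.2 ?_)
    (Submodule.isClosed_topologicalClosure _)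
  rintro _ ⟨e, γ, rfl⟩
  rw [← b.translate_edge, ← b.translate_projRel]
  exact translate_mem_inducedL2 b (fun _ _ _ => Submodule.mem_top) γ Submodule.mem_top

theorem rightMulMatrix_chainMatrix_mem_inducedL2 (hW : IsPi1Stable W)
    {y : H.CoEdge → relChain f.base H} (hy : ∀ e, y e ∈ W) (ξ : L2n H.CoEdge f.FreeByCyclic) :
    rightMulMatrix (b.chainMatrix 1 fun e => (y e : Chain₁ f.base)) ξ ∈ f.inducedL2 b W := by
  set B := rightMulMatrix (b.chainMatrix 1 fun e => (y e : Chain₁ f.base)) with hB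
  refine L2n.basisVec_induction (p := fun ξ => B ξ ∈ f.inducedL2 b W)
    ((Submodule.isClosed_topologicalClosure _).preimage B.continuous) ?_ ?_ ?_ ξ
  · rw [map_zero]
    exact zero_mem _
  · intro ξ η hξ hη
    rw [map_add]
    exact add_mem hξ hη
  · intro c e γ
    rw [map_smul, hB, b.rightMulMatrix_chainMatrix, mul_one]
    exact Submodule.smul_mem _ c (translate_mem_inducedL2 b hW γ (hy e))

theorem inducedL2_sup_eq_top (hW : IsPi1Stable W) (hW' : IsPi1Stable W') (h : W ⊔ W' = ⊤) :
    f.inducedL2 b W ⊔ f.inducedL2 b W' = ⊤ := by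
  have hdecomp (e : H.CoEdge) : ∃ y ∈ W, ∃ y' ∈ W',
      y + y' = projRel f.base H (Finsupp.single (b.edge e) 1) :=
    Submodule.mem_sup.1 (h ▸ Submodule.mem_top)
  choose y hy y' hy' hadd using hdecomp
  have hid : rightMulMatrix (b.chainMatrix 1 fun e => (y e : Chain₁ f.base)) +
      rightMulMatrix (b.chainMatrix 1 fun e => (y' e : Chain₁ f.base)) =
        ContinuousLinearMap.id ℂ (L2n H.CoEdge f.FreeByCyclic) := by
    refine L2n.continuousLinearMap_ext fun e γ => ?_
    rw [add_apply, b.rightMulMatrix_chainMatrix, b.rightMulMatrix_chainMatrix, mul_one, ← map_add,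
      ← Submodule.coe_add, hadd, b.translate_projRel, b.translate_edge,
      ContinuousLinearMap.id_apply]
  refine (Submodule.eq_top_iff').2 fun ξ => Submodule.mem_sup.2 ⟨_,
    rightMulMatrix_chainMatrix_mem_inducedL2 b hW hy ξ, _,
    rightMulMatrix_chainMatrix_mem_inducedL2 b hW' hy' ξ, DFunLike.congr_fun hid ξ⟩

/-- The additive group of the translates by `γ ∈ G_φ` of the chains in `W`. Its closure is only a
real subspace of `L²(G_φ)^{n_H}`. -/
def EdgeLifts.translateSubgroup (γ : f.FreeByCyclic) (W : Submodule ℚ (relChain f.base H)) :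
    AddSubgroup (L2n H.CoEdge f.FreeByCyclic) :=
  W.toAddSubgroup.map ((b.translate γ).comp (relChain f.base H).subtype.toAddMonoidHom)

theorem EdgeLifts.smul_translate_mem_closure (γ : f.FreeByCyclic) (c : ℝ)
    {x : relChain f.base H} (hx : x ∈ W) :
    (c : ℂ) • b.translate γ (x : Chain₁ f.base) ∈
      (b.translateSubgroup γ W).topologicalClosure := by
  refine map_mem_closure (f := fun c : ℝ => (c : ℂ) • b.translate γ (x : Chain₁ f.base))
    (Complex.continuous_ofReal.smul continuous_const) (Rat.denseRange_cast c) ?_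
  rintro _ ⟨q, rfl⟩
  refine ⟨q • x, W.smul_mem q hx, ?_⟩
  change b.translate γ (q • (x : Chain₁ f.base)) = ((q : ℝ) : ℂ) • _
  rw [b.translate_smul, Complex.ofReal_ratCast]

theorem realPart_coset_mem_closure (l : ℤ) {ξ : L2n H.CoEdge f.FreeByCyclic}
    (hξ : ξ ∈ f.inducedL2 b W) :
    realPart (f.coset l) ξ ∈ (b.translateSubgroup (f.t ^ l) W).topologicalClosure := by
  rw [inducedL2_eq_topologicalClosure_span] at hξ
  refine mem_topologicalClosure_span_induction
    ((AddSubgroup.isClosed_topologicalClosure _).preimage (continuous_realPart _)) ?_ ?_ ?_ hξ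
  · rw [map_zero]
    exact zero_mem _
  · intro ξ η hξ hη
    rw [map_add]
    exact add_mem hξ hη
  · rintro c _ ⟨k, x, hx, rfl⟩
    rw [realPart_coset_smul_translate]
    by_cases hk : k = l
    · subst hk
      rw [Set.indicator_of_mem (t_zpow_mem_coset_iff.2 rfl)]
      exact b.smul_translate_mem_closure _ _ hx
    · rw [Set.indicator_of_notMem (mt t_zpow_mem_coset_iff.1 hk), zero_smul]
      exact zero_mem _

theorem exists_translate_mem_of_realPart_coset (l : ℤ) {ξ : L2n H.CoEdge f.FreeByCyclic}
    (hξ : ξ ∈ f.inducedL2 b W) {O : Set (L2n H.CoEdge f.FreeByCyclic)}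
    (hO : O ∈ 𝓝 (realPart (f.coset l) ξ)) :
    ∃ x ∈ W, b.translate (f.t ^ l) (x : Chain₁ f.base) ∈ O := by
  obtain ⟨_, hmem, x, hx, rfl⟩ :=
    mem_closure_iff_nhds.1 (realPart_coset_mem_closure b l hξ) O hO
  exact ⟨x, hx, hmem⟩

end BasedHomotopyEquiv

section AngleCone

open scoped InnerProductSpace

variable {𝕜 E : Type*} [RCLike 𝕜] [NormedAddCommGroup E] [InnerProductSpace 𝕜 E] {θ : ℝ}

variable (𝕜) in
/-- The vectors that make an angle of cosine larger than `θ` with `v`. -/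
def angleCone (θ : ℝ) (v : E) : Set E :=
  {η | θ * ‖v‖ * ‖η‖ < RCLike.re ⟪v, η⟫_𝕜}

theorem isOpen_angleCone (v : E) : IsOpen (angleCone 𝕜 θ v) :=
  isOpen_lt (continuous_const.mul continuous_norm)
    (RCLike.continuous_re.comp (continuous_const.inner continuous_id))

theorem exists_mem_angleCone_of_mem_closure (hθ : θ < 1) {s : Set E} {ω : E}
    (hω : ω ∈ closure s) (hne : ω ≠ 0) : ∃ v ∈ s, ω ∈ angleCone 𝕜 θ v := by
  have hself : θ * ‖ω‖ * ‖ω‖ < RCLike.re ⟪ω, ω⟫_𝕜 := by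
    rw [inner_self_eq_norm_mul_norm, mul_assoc]
    exact mul_lt_of_lt_one_left (by positivity) hθ
  have hopen : IsOpen {v : E | ω ∈ angleCone 𝕜 θ v} :=
    isOpen_lt ((continuous_const.mul continuous_norm).mul continuous_const)
      (RCLike.continuous_re.comp (continuous_id.inner continuous_const))
  obtain ⟨v, hv, hvs⟩ := mem_closure_iff.1 hω _ hopen hself
  exact ⟨v, hvs, hv⟩

end AngleCone

namespace BasedHomotopyEquiv

variable {V : Type u} [Quiver.{v} V] {f : BasedHomotopyEquiv V} {H : Subgraph V}

variable (f) in
/-- The flaring inequality of the chain flare condition, for the chains in the set `N^∞`. -/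
def FlaresOn (lam : ℝ) (N : Set (relChain f.base H)) : Prop :=
  ∀ x ∈ f.saturate H N, lam * chainNorm (f.ARel H x : Chain₁ f.base) ≤
    max (chainNorm (f.ARel H (f.ARel H x) : Chain₁ f.base)) (chainNorm (x : Chain₁ f.base))

theorem ARel_pow_mem_saturate {N : Set (relChain f.base H)} {x : relChain f.base H} {j : ℕ}
    (hx : (f.ARel H ^ j) x ∈ N) (k : ℕ) : (f.ARel H ^ k) x ∈ f.saturate H N := by
  rcases le_total k j with hkj | hjk
  · refine ⟨j - k, Or.inr ?_⟩
    rwa [← Module.End.mul_apply, ← pow_add, Nat.sub_add_cancel hkj]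
  · refine ⟨k - j, Or.inl ⟨_, hx, ?_⟩⟩
    rw [← Module.End.mul_apply, ← pow_add, Nat.sub_add_cancel hjk]

variable [Finite (Quiver.Total V)] {b : f.EdgeLifts H} {W : Submodule ℚ (relChain f.base H)}
  {lam θ ν μ : ℝ} {l : ℤ} {ξ : L2n H.CoEdge f.FreeByCyclic}

theorem FlaresOn.flares_L_pow_translate {N : Set (relChain f.base H)} (h : f.FlaresOn lam N)
    {x : relChain f.base H} {j : ℕ} (hx : (f.ARel H ^ j) x ∈ N) (γ : f.FreeByCyclic) :
    Flares lam fun k => ‖(f.L b ^ k) (b.translate γ (x : Chain₁ f.base))‖ := by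
  simp only [b.L_pow_translate, b.norm_translate]
  intro k
  simp only [pow_succ', Module.End.mul_apply]
  exact h _ (ARel_pow_mem_saturate hx k)

theorem mem_angleNhd_of_translate_mem_angleCone {γ : f.FreeByCyclic} {x x' : relChain f.base H}
    (hx : x ∈ W) (h : b.translate γ (x' : Chain₁ f.base) ∈
      angleCone ℂ θ (b.translate γ (x : Chain₁ f.base))) : x' ∈ angleNhd θ W := by
  rw [angleCone, Set.mem_ofPred_eq, b.norm_translate, b.norm_translate, b.inner_translate] at h
  exact ⟨x, hx, h⟩

theorem eventually_translate_mem_angleNhd (hθ : θ < 1) (hξ : ξ ∈ f.inducedL2 b W)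
    (hne : realPart (f.coset l) ξ ≠ 0) :
    ∀ᶠ ζ in 𝓝 (realPart (f.coset l) ξ), ∀ x : relChain f.base H,
      b.translate (f.t ^ l) (x : Chain₁ f.base) = ζ → x ∈ angleNhd θ W := by
  obtain ⟨_, ⟨x, hx, rfl⟩, hmem⟩ := exists_mem_angleCone_of_mem_closure (𝕜 := ℂ) hθ
    (realPart_coset_mem_closure b l hξ) hne
  filter_upwards [(isOpen_angleCone _).mem_nhds hmem]
  rintro _ hζ x' rfl
  exact mem_angleNhd_of_translate_mem_angleCone hx hζ

variable (b l) in
theorem exists_translate_mem_nhds {O : Set (L2n H.CoEdge f.FreeByCyclic)}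
    (hO : O ∈ 𝓝 (realPart (f.coset l) ξ)) :
    ∃ x : relChain f.base H, b.translate (f.t ^ l) (x : Chain₁ f.base) ∈ O := by
  obtain ⟨x, -, hx⟩ := exists_translate_mem_of_realPart_coset b l (W := ⊤) (ξ := ξ)
    (inducedL2_top b ▸ Submodule.mem_top) hO
  exact ⟨x, hx⟩

theorem eventually_exists_translate_forward (hν : 0 ≤ ν) (hμ : ν < μ)
    (hξ : ξ ∈ growthSubmodule (fun _ => LinearMap.id) (fun j => (f.L b ^ j).toLinearMap) hν)
    {O : Set (L2n H.CoEdge f.FreeByCyclic)} (hO : O ∈ 𝓝 (realPart (f.coset l) ξ)) :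
    ∀ᶠ j : ℕ in atTop, ∃ x : relChain f.base H, b.translate (f.t ^ l) (x : Chain₁ f.base) ∈ O ∧
      ‖(f.L b ^ j) (b.translate (f.t ^ l) (x : Chain₁ f.base))‖ < μ ^ j := by
  filter_upwards [hξ μ hμ _ ((continuous_realPart (f.coset l)).tendsto ξ
    (interior_mem_nhds.2 hO))] with j ⟨η, hη, hlt⟩
  refine exists_translate_mem_nhds b l (ξ := η) (O := O ∩ {ζ | ‖(f.L b ^ j) ζ‖ < μ ^ j})
    (inter_mem (mem_interior_iff_mem_nhds.1 hη) ?_)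
  refine (isOpen_lt (f.L b ^ j).continuous.norm continuous_const).mem_nhds ?_
  rw [Set.mem_ofPred_eq, ← realPart_coset_L_pow]
  exact (norm_realPart_le _ _).trans_lt hlt

theorem eventually_exists_translate_backward (hν : 0 ≤ ν) (hμ : ν < μ)
    (hξ : ξ ∈ growthSubmodule (fun j => (f.L b ^ j).toLinearMap) (fun _ => LinearMap.id) hν)
    {O : Set (L2n H.CoEdge f.FreeByCyclic)} (hO : O ∈ 𝓝 (realPart (f.coset l) ξ)) :
    ∀ᶠ j : ℕ in atTop, ∃ x : relChain f.base H,
      (f.L b ^ j) (b.translate (f.t ^ (l - j)) (x : Chain₁ f.base)) ∈ O ∧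
        ‖b.translate (f.t ^ (l - j)) (x : Chain₁ f.base)‖ < μ ^ j := by
  filter_upwards [hξ μ hμ _ ((continuous_realPart (f.coset l)).tendsto ξ
    (interior_mem_nhds.2 hO))] with j ⟨η, hη, hlt⟩
  refine exists_translate_mem_nhds b (l - j) (ξ := η)
    (O := (f.L b ^ j) ⁻¹' O ∩ {ζ | ‖ζ‖ < μ ^ j}) (inter_mem ?_ ?_)
  · refine (f.L b ^ j).continuous.continuousAt.preimage_mem_nhds ?_
    rw [← realPart_coset_L_pow, sub_add_cancel]
    exact mem_interior_iff_mem_nhds.1 hη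
  · exact (isOpen_lt continuous_norm continuous_const).mem_nhds
      ((norm_realPart_le _ _).trans_lt hlt)

theorem realPart_coset_eq_zero_of_flaresOn (hlam : 1 < lam) (hθ : θ < 1)
    (hflare : f.FlaresOn lam (angleNhd θ W)) (hν : 0 ≤ ν) (hνlam : ν < lam)
    (hξ : ξ ∈ f.inducedL2 b W) (hξν : ξ ∈ hsSubmodule (f.L b) hν) (l : ℤ) :
    realPart (f.coset l) ξ = 0 := by
  by_contra hne
  obtain ⟨μ, hνμ, hμlam⟩ := exists_between hνlam
  have hcone := eventually_translate_mem_angleNhd hθ hξ hne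
  refine hne (eq_zero_of_frequently_flares (f.L b).continuous hlam (hν.trans_lt hνμ) hμlam
    (fun O hO => ?_) fun O hO => ?_)
  · refine Eventually.frequently ?_
    filter_upwards [eventually_exists_translate_forward hν hνμ hξν.1 (inter_mem hO hcone)]
      with j ⟨x, ⟨hxO, hx⟩, hlt⟩
    simp only [← FunLike.coe_pow_eq_iterate]
    exact ⟨_, hxO, hflare.flares_L_pow_translate (j := 0) (hx x rfl) _, hlt⟩
  · refine Eventually.frequently ?_
    filter_upwards [eventually_exists_translate_backward hν hνμ hξν.2 (inter_mem hO hcone)]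
      with j ⟨x, ⟨hxO, hx⟩, hlt⟩
    have hmem : (f.ARel H ^ j) x ∈ angleNhd θ W := hx _ (by
      rw [b.L_pow_translate, ← zpow_natCast, ← zpow_add, sub_add_cancel])
    simp only [← FunLike.coe_pow_eq_iterate]
    exact ⟨_, hxO, hflare.flares_L_pow_translate hmem _, hlt⟩

section QuasiFixed

variable {ρ : relChain f.base H}

theorem L_pow_translate_of_ARel_eq_self (hρ : f.ARel H ρ = ρ) (j : ℕ) (γ : f.FreeByCyclic) :
    (f.L b ^ j) (b.translate γ (ρ : Chain₁ f.base)) =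
      b.translate (γ * f.t ^ j) (ρ : Chain₁ f.base) := by
  rw [b.L_pow_translate, Module.End.pow_apply, Function.iterate_fixed hρ]

theorem translate_mem_hsSubmodule (hρ : f.ARel H ρ = ρ) (hν : 1 ≤ ν) (γ : f.FreeByCyclic) :
    b.translate γ (ρ : Chain₁ f.base) ∈ hsSubmodule (f.L b) (zero_le_one.trans hν) := by
  refine ⟨mem_growthSubmodule_of_bounded hν (chainNorm (ρ : Chain₁ f.base)) fun j => ⟨_, rfl, ?_⟩,
    mem_growthSubmodule_of_bounded hν (chainNorm (ρ : Chain₁ f.base)) fun j =>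
      ⟨b.translate (γ * (f.t ^ j)⁻¹) (ρ : Chain₁ f.base), ?_, (b.norm_translate _ ρ).le⟩⟩
  · exact ((congrArg _ (L_pow_translate_of_ARel_eq_self hρ j γ)).trans
      (b.norm_translate _ ρ)).le
  · exact (L_pow_translate_of_ARel_eq_self hρ j _).trans (by rw [inv_mul_cancel_right])

theorem inducedL2_le_hsSubmodule (hW : W ≤ f.quasiFixed H) (hν : 1 ≤ ν) :
    f.inducedL2 b W ≤ hsSubmodule (f.L b) (zero_le_one.trans hν) := by
  rw [inducedL2_eq_topologicalClosure_span]
  refine Submodule.topologicalClosure_minimal _ (Submodule.span_le.2 ?_)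
    (isClosed_hsSubmodule _ _)
  rintro _ ⟨l, x, hx, rfl⟩
  replace hx := hW hx
  induction hx using Submodule.span_induction with
  | mem x hx =>
    obtain ⟨g, ρ, hρ, rfl⟩ := hx
    change b.translate _ (chainAct g (ρ : Chain₁ f.base)) ∈ _
    rw [b.translate_chainAct]
    exact translate_mem_hsSubmodule hρ hν _
  | zero =>
    rw [ZeroMemClass.coe_zero, map_zero]
    exact zero_mem _
  | add x y _ _ hx hy =>
    rw [Submodule.coe_add, map_add]
    exact add_mem hx hy
  | smul c x _ hx =>
    rw [Submodule.coe_smul, b.translate_smul]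
    exact Submodule.smul_mem _ _ hx

end QuasiFixed

end BasedHomotopyEquiv

end ChainFlare

end

open ChainFlare BasedHomotopyEquiv in
theorem mainTheorem7_general {V : Type u} [Quiver.{v} V] [Finite (Quiver.Total V)]
    {f : BasedHomotopyEquiv V} {H : Subgraph V} (b : f.EdgeLifts H)
    {Vh Vqf : Submodule ℚ (relChain f.base H)} (hVh : IsPi1Stable Vh) (hVqf : IsPi1Stable Vqf)
    (hsup : Vh ⊔ Vqf = ⊤) {lam θ : ℝ} (hlam : 1 < lam) (hθ : θ < 1)
    (hflare : f.FlaresOn lam (angleNhd θ Vh)) (hfixed : Vqf ≤ f.quasiFixed H)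
    {ν : ℝ} (hν : 1 ≤ ν) (hνlam : ν < lam) :
    (f.inducedL2 b Vqf : Set (L2n H.CoEdge f.FreeByCyclic)) =
      hsE (f.L b) ν ∩ hsF (f.L b) ν⁻¹ := by
  have hν₀ : 0 ≤ ν := zero_le_one.trans hν
  have hle : f.inducedL2 b Vqf ≤ hsSubmodule (f.L b) hν₀ := inducedL2_le_hsSubmodule hfixed hν
  rw [← coe_hsSubmodule _ hν₀]
  refine Set.Subset.antisymm hle fun ξ hξ => ?_
  obtain ⟨η, hη, ζ, hζ, rfl⟩ := Submodule.mem_sup.1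
    (inducedL2_sup_eq_top b hVh hVqf hsup ▸ Submodule.mem_top : ξ ∈ _)
  have hmem : η ∈ hsSubmodule (f.L b) hν₀ := (add_mem_cancel_right (hle hζ)).1 hξ
  have hzero : η = 0 := eq_zero_of_realPart_smul exists_mem_coset fun c l =>
    realPart_coset_eq_zero_of_flaresOn hlam hθ hflare hν₀ hνlam (Submodule.smul_mem _ c hη)
      (Submodule.smul_mem _ c hmem) l
  rwa [hzero, zero_add]

theorem mainTheorem7 {V : Type u} [Quiver.{v} V] [Finite (Quiver.Total V)]
    (hV : ChainFlare.IsConnectedGraph V)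
    (f : ChainFlare.BasedHomotopyEquiv V)
    (H : ChainFlare.Subgraph V) (hH : H.Invariant f.toCellularMap)
    (b : f.EdgeLifts H)
    (Vh Vqf : Submodule ℚ (ChainFlare.relChain f.base H))
    (hflare : f.ChainFlareCondition H Vh Vqf) :
    ∃ lam : ℝ, 1 < lam ∧ ∀ ν : ℝ, 1 ≤ ν → ν < lam →
      (f.inducedL2 b Vqf : Set (ChainFlare.L2n H.CoEdge f.FreeByCyclic)) =
        ChainFlare.hsE (f.L b) ν ∩ ChainFlare.hsF (f.L b) ν⁻¹ := by
  obtain ⟨lam, θ, hlam, -, hθ, hlamθ⟩ := hflare.flare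
  exact ⟨lam, hlam, fun ν hν hνlam => mainTheorem7_general b hflare.stable_h hflare.stable_qf
    hflare.sup_eq_top hlam hθ hlamθ (hflare.le_quasiFixed hH) hν hνlam⟩
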